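/- For $N\ge 1$ let $\zeta_N=e^{2\pi i/N}$. Let $F$ be a number field, regarded as a subfield of $\mathbb{C}$ through an arbitrary embedding. Let $q$ be a prime, $n,k$ natural numbers and $t,r$ integers such that $q\nmid n$, $k\mid n$, $q\mid t(r-1)$ and the multiplicative order of $r$ modulo $q$ is $o_q(r)=n/k$. Let $$G=\langle a\rangle_q\rtimes_k\langle b\rangle_n=\langle a,b\mid a^q=1,\ b^n=a^t,\ b^{-1}ab=a^r\rangle .$$ The number of simple components of the group algebra $FG$ is called minimal if it equals the number of simple components of $\mathbb{Q}G$. Let $\langle b\rangle$ act on $\mathbb{Q}(\zeta_{qk})$ by field automorphisms through $b\cdot\zeta_q=\zeta_q^r$ and $b\cdot\zeta_k=\zeta_k$, and let $\mathbb{Q}(\zeta_{qk})^{\langle b\rangle}$ be the fixed subfield. Then the number of simple components of $FG$ is minimal if and only if $$\mathbb{Q}(\zeta_n)\cap F=\mathbb{Q}\quad\text{and}\quad \mathbb{Q}(\zeta_{qk})^{\langle b\rangle}\cap F=\mathbb{Q}.$$ Moreover, the condition $\mathbb{Q}(\zeta_n)\cap F=\mathbb{Q}$ is equivalent to $|I_n(F)|=\varphi(n)$,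 where $I_n(F)$ is the image of the embedding $\mathrm{Gal}(F(\zeta_n)/F)\to(\mathbb{Z}/n\mathbb{Z})^\times$ sending $\sigma$ to the class of $u$ with $\sigma(\zeta_n)=\zeta_n^u$. -/

import Mathlib

namespace MetacyclicGroupAlgebra

/-- The number of simple components of a semisimple ring `A`: its simple components are the
minimal nonzero two-sided ideals of `A`. -/
noncomputable def numSimpleComponents (A : Type*) [Ring A] : ℕ :=
  {I : TwoSidedIdeal A | IsAtom I}.ncard

/-- The number of simple components of `FG` is minimal: it equals the number of simple components
of the rational group algebra `ℚG`. -/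
def HasMinimalComponents (F : Type*) [Field F] (G : Type*) [Group G] : Prop :=
  numSimpleComponents (MonoidAlgebra F G) = numSimpleComponents (MonoidAlgebra ℚ G)

/-- The relations `a ^ m = 1`, `b ^ n = a ^ t`, `b⁻¹ a b = a ^ r` on the free group on the two
letters `a = of true` and `b = of false`. -/
def metacyclicRels (m n : ℕ) (t r : ℤ) : Set (FreeGroup Bool) :=
  let a := FreeGroup.of true
  let b := FreeGroup.of false
  {a ^ m, b ^ n * (a ^ t)⁻¹, b⁻¹ * a * b * (a ^ r)⁻¹}

/-- The group `⟨a, b | a ^ m = 1, b ^ n = a ^ t, b⁻¹ a b = a ^ r⟩`. -/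
abbrev MetacyclicGroup (m n : ℕ) (t r : ℤ) : Type :=
  PresentedGroup (metacyclicRels m n t r)

/-- The complex primitive `n`-th root of unity `ζ_n = exp (2 π i / n)`. -/
noncomputable def zeta (n : ℕ) : ℂ := Complex.exp (2 * Real.pi * Complex.I / n)

theorem zeta_isPrimitiveRoot {n : ℕ} (hn : n ≠ 0) : IsPrimitiveRoot (zeta n) n :=
  Complex.isPrimitiveRoot_exp n hn

/-- The cyclotomic field `ℚ(ζ_n)` inside `ℂ`. -/
noncomputable abbrev cyclo (n : ℕ) : IntermediateField ℚ ℂ :=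
  IntermediateField.adjoin ℚ {zeta n}

/-- `ζ_n` as an element of `ℚ(ζ_n)`. -/
noncomputable def zetaGen (n : ℕ) : cyclo n :=
  IntermediateField.AdjoinSimple.gen ℚ (zeta n)

theorem coe_zetaGen (n : ℕ) : (zetaGen n : ℂ) = zeta n := rfl

/-- `ζ_q = ζ_{qk} ^ k`. -/
theorem coe_zetaGen_pow_left (q : ℕ) {k : ℕ} (hk : k ≠ 0) :
    ((zetaGen (q * k) ^ k : cyclo (q * k)) : ℂ) = zeta q := by
  have hk' : (k : ℂ) ≠ 0 := by exact_mod_cast hk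
  rw [IntermediateField.coe_pow, coe_zetaGen, zeta, zeta, ← Complex.exp_nat_mul]
  congr 1
  rcases eq_or_ne q 0 with rfl | hq
  · simp
  · have hq' : (q : ℂ) ≠ 0 := by exact_mod_cast hq
    push_cast
    field_simp

/-- `ζ_k = ζ_{qk} ^ q`. -/
theorem coe_zetaGen_pow_right {q : ℕ} (hq : q ≠ 0) (k : ℕ) :
    ((zetaGen (q * k) ^ q : cyclo (q * k)) : ℂ) = zeta k := by
  have h := coe_zetaGen_pow_left k hq
  rw [IntermediateField.coe_pow, coe_zetaGen] at h ⊢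
  rwa [mul_comm q k]

/-- The automorphisms `σ` of `ℚ(ζ_{qk})` with `σ ζ_q = ζ_q ^ r` and `σ ζ_k = ζ_k`, where
`ζ_q = ζ_{qk} ^ k` and `ζ_k = ζ_{qk} ^ q`. By `existsUnique_bAut` there is exactly one such `σ`
when `q` is coprime to `k` and to `r`; it describes the action of `b`. -/
def bAut (q k : ℕ) (r : ℤ) : Set (cyclo (q * k) ≃ₐ[ℚ] cyclo (q * k)) :=
  {σ | σ (zetaGen (q * k) ^ k) = (zetaGen (q * k) ^ k) ^ r ∧
    σ (zetaGen (q * k) ^ q) = zetaGen (q * k) ^ q}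

/-- The fixed field `ℚ(ζ_{qk})^⟨b⟩`, as a subfield of `ℂ`. -/
noncomputable def bFixed (q k : ℕ) (r : ℤ) : IntermediateField ℚ ℂ :=
  IntermediateField.lift (IntermediateField.fixedField (Subgroup.closure (bAut q k r)))

theorem existsUnique_bAut {q k : ℕ} {r : ℤ} (hq : q ≠ 0) (hk : k ≠ 0) (hqk : q.Coprime k)
    (hr : IsCoprime r q) : ∃! σ, σ ∈ bAut q k r := by
  have hm : q * k ≠ 0 := mul_ne_zero hq hk
  have : NeZero (q * k) := ⟨hm⟩
  have hz : IsPrimitiveRoot (zeta (q * k)) (q * k) := zeta_isPrimitiveRoot hm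
  have hg : IsPrimitiveRoot (zetaGen (q * k)) (q * k) := by
    refine IsPrimitiveRoot.of_map_of_injective (f := (cyclo (q * k)).val) ?_
      (cyclo (q * k)).val.injective
    exact hz
  have : IsCyclotomicExtension {q * k} ℚ (cyclo (q * k)) :=
    (IntermediateField.isCyclotomicExtension_singleton_iff_eq_adjoin _ _ _ _ hz).mpr rfl
  have hcop : IsCoprime (q : ℤ) (k : ℤ) := Nat.isCoprime_iff_coprime.mpr hqk
  obtain ⟨x, y, hxy⟩ := hcop
  have hg0 : zetaGen (q * k) ≠ 0 := hg.ne_zero hm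
  -- the integer `u` with `u ≡ r mod q` and `u ≡ 1 mod k`
  set u : ℤ := x * q + y * k * r with hu
  have huq : u = r + q * (x * (1 - r)) := by linear_combination r * hxy
  have huk : u = 1 + k * (y * (r - 1)) := by linear_combination hxy
  have hucop : IsCoprime u ((q * k : ℕ) : ℤ) := by
    push_cast
    refine IsCoprime.mul_right ?_ ?_
    · rw [huq]; exact hr.add_mul_left_left _
    · rw [huk]; exact isCoprime_one_left.add_mul_left_left _
  have hgu : IsPrimitiveRoot (zetaGen (q * k) ^ u) (q * k) :=
    hg.zpow_of_gcd_eq_one u (Int.isCoprime_iff_gcd_eq_one.mp hucop)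
  have hirr : Irreducible (Polynomial.cyclotomic (q * k) ℚ) :=
    Polynomial.cyclotomic.irreducible_rat (Nat.pos_of_ne_zero hm)
  have hmin : minpoly ℚ (hg.powerBasis ℚ).gen = minpoly ℚ (hgu.powerBasis ℚ).gen := by
    rw [hg.powerBasis_gen ℚ, hgu.powerBasis_gen ℚ,
      ← hg.minpoly_eq_cyclotomic_of_irreducible hirr,
      ← hgu.minpoly_eq_cyclotomic_of_irreducible hirr]
  have hσ : ∃ σ : cyclo (q * k) ≃ₐ[ℚ] cyclo (q * k),
      σ (zetaGen (q * k)) = zetaGen (q * k) ^ u := by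
    refine ⟨(hg.powerBasis ℚ).equivOfMinpoly (hgu.powerBasis ℚ) hmin, ?_⟩
    have h := PowerBasis.equivOfMinpoly_gen (hg.powerBasis ℚ) (hgu.powerBasis ℚ) hmin
    rwa [hg.powerBasis_gen ℚ, hgu.powerBasis_gen ℚ] at h
  obtain ⟨σ, hσg⟩ := hσ
  have hone : zetaGen (q * k) ^ ((q : ℤ) * k) = 1 := by
    have h := hg.pow_eq_one
    rw [← zpow_natCast] at h
    exact_mod_cast h
  have hmul : ∀ z : ℤ, zetaGen (q * k) ^ ((q : ℤ) * k * z) = 1 := fun z => by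
    rw [zpow_mul, hone, one_zpow]
  refine ⟨σ, ⟨?_, ?_⟩, ?_⟩
  · rw [map_pow, hσg, ← zpow_natCast, ← zpow_mul, ← zpow_natCast, ← zpow_mul,
      show u * (k : ℤ) = k * r + q * k * (x * (1 - r)) by rw [huq]; ring,
      zpow_add₀ hg0, hmul, mul_one]
  · rw [map_pow, hσg, ← zpow_natCast, ← zpow_mul, ← zpow_natCast,
      show u * (q : ℤ) = q + q * k * (y * (r - 1)) by rw [huk]; ring,
      zpow_add₀ hg0, hmul, mul_one]
  · rintro τ ⟨h1, h2⟩
    have hgen : zetaGen (q * k) =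
        (zetaGen (q * k) ^ q) ^ x * (zetaGen (q * k) ^ k) ^ y := by
      rw [← zpow_natCast, ← zpow_mul, ← zpow_natCast, ← zpow_mul, ← zpow_add₀ hg0,
        show (q : ℤ) * x + k * y = 1 by linear_combination hxy, zpow_one]
    have hτg : τ (zetaGen (q * k)) = zetaGen (q * k) ^ u := by
      conv_lhs => rw [hgen]
      rw [map_mul, map_zpow₀, map_zpow₀, h1, h2, ← zpow_natCast, ← zpow_mul, ← zpow_natCast,
        ← zpow_mul, ← zpow_mul, ← zpow_add₀ hg0]
      congr 1
      rw [hu]; ring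
    have hfun : (τ : cyclo (q * k) →ₐ[ℚ] cyclo (q * k)) = σ := by
      refine (hg.powerBasis ℚ).algHom_ext ?_
      rw [hg.powerBasis_gen ℚ]
      exact hτg.trans hσg.symm
    exact AlgEquiv.ext fun z => DFunLike.congr_fun hfun z

/-- `I_n(K)`: the image of `Gal(K(ζ_n)/K)` in `(ℤ/nℤ)ˣ`, where `σ` is sent to the class `u` with
`σ ζ_n = ζ_n ^ u`. -/
def galImage (n : ℕ) (K : IntermediateField ℚ ℂ) : Set (ZMod n)ˣ :=
  {u | ∃ σ : IntermediateField.adjoin K {zeta n} ≃ₐ[K] IntermediateField.adjoin K {zeta n},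
    σ (IntermediateField.AdjoinSimple.gen K (zeta n)) =
      IntermediateField.AdjoinSimple.gen K (zeta n) ^ (u : ZMod n).val}

end MetacyclicGroupAlgebra

/-!
Write `S` for the center of `ℚG`. A finite-dimensional semisimple algebra has as many simple
components as its center has prime ideals, because its two-sided ideals correspond to the central
idempotents (`numSimpleComponents_eq_card_primeSpectrum`). The center of `FG` is `F ⊗ S`
(`centerTensorEquiv`), so the components of `FG` are counted by `Spec (F ⊗ S)` and those of `ℚG` by
`Spec S`. The map `Spec (F ⊗ S) → Spec S` is surjective, with fibers `Spec (F ⊗ κ)` for the residue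
fields `κ` of `S`; hence the number is minimal if and only if every `F ⊗ κ` is a field. When the
fields `κ` are Galois over `ℚ`, this says that the image of each homomorphism `φ : S → ℂ` meets `F`
in `ℚ` (`hasMinimalComponents_iff`).

It remains to find the images of the homomorphisms `φ`. Replacing `b` by a product `b a ^ s` reduces
to the relation `b ^ n = 1` (`exists_split_generators`). Let `e` be the idempotent
`(1 / q) ∑ a ^ l`, which is central, so that `φ e` is `0` or `1`.

* If `φ e = 1`, then `φ` factors through the group algebra of the cyclic group `G / ⟨a⟩`, and its
  image lies in `ℚ(ζ_n)` (`adjoin_range_le_cyclo`).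
* If `φ e = 0`, put `m = n / k`. Averaging a central element over conjugates shows that modulo `e`
  the center is spanned by the orbit sums of `b ^ j a ^ i` with `m ∣ j`. Extending `φ` to the
  commutative algebra generated by `a` shows that the values of `φ` at the orbit sums are traces of
  roots of unity from `ℚ(ζ_qk)` to `ℚ(ζ_qk)^⟨b⟩` (`adjoin_range_le_bFixed`).

All images therefore lie in cyclotomic fields, hence are abelian over `ℚ`. Conversely, the linear
character `a ↦ 1`, `b ↦ ζ_n` gives a homomorphism whose image contains `ζ_n`
(`exists_algHom_zeta_mem_range`), and the central character of a representation induced from a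
faithful character of `⟨a, b ^ m⟩` takes all the traces as values, which span `ℚ(ζ_qk)^⟨b⟩`
(`exists_algHom_bFixed_le`).

Finally `|I_n(F)|` is the degree of `F(ζ_n)` over `F`, and both conditions on `ℚ(ζ_n)` say that it
is linearly disjoint from `F` (`inf_cyclo_eq_bot_iff`).
-/

open scoped TensorProduct

namespace MetacyclicGroupAlgebra

/-! ### Simple components and the spectrum of the center -/

section SimpleComponents

/-- A complement of a two-sided ideal as a left ideal splits off a right identity: the component
of `1` in the ideal. -/
theorem exists_right_identity {A : Type*} [Ring A] [IsSemisimpleRing A] (I : TwoSidedIdeal A) :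
    ∃ e ∈ I, ∀ x ∈ I, x * e = x := by
  let L : Submodule A A :=
    { carrier := I
      add_mem' := I.add_mem
      zero_mem' := I.zero_mem
      smul_mem' := fun c x hx => I.mul_mem_left c x hx }
  obtain ⟨J, hJ⟩ := exists_isCompl L
  have h1 : (1 : A) ∈ L ⊔ J := by rw [hJ.sup_eq_top]; trivial
  obtain ⟨e, he, f, hf, hef⟩ := Submodule.mem_sup.mp h1
  refine ⟨e, he, fun x hx => ?_⟩
  -- `x * f` lies in both summands: `I` is a right ideal and `J` is a left ideal
  have h0 : x * f ∈ L ⊓ J := ⟨I.mul_mem_right x f hx, J.smul_mem x hf⟩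
  rw [hJ.inf_eq_bot, Submodule.mem_bot] at h0
  calc x * e = x * (e + f) := by rw [mul_add, h0, add_zero]
    _ = x := by rw [hef, mul_one]

theorem exists_left_identity {A : Type*} [Ring A] [IsSemisimpleRing A] (I : TwoSidedIdeal A) :
    ∃ e ∈ I, ∀ x ∈ I, e * x = x := by
  have : IsSemisimpleRing Aᵐᵒᵖ := isSemisimpleRing_mulOpposite_iff.mpr inferInstance
  obtain ⟨e, he, h⟩ := exists_right_identity I.op
  refine ⟨e.unop, TwoSidedIdeal.mem_op_iff.mp he, fun x hx => ?_⟩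
  have := h (MulOpposite.op x) (TwoSidedIdeal.mem_op_iff.mpr hx)
  exact congrArg MulOpposite.unop this

/-- A two-sided ideal of a semisimple ring has a left and a right identity; they agree, and the
common value is a central idempotent generating the ideal. -/
theorem exists_central_idempotent {A : Type*} [Ring A] [IsSemisimpleRing A]
    (I : TwoSidedIdeal A) :
    ∃ e, (∀ x, x * e = e * x) ∧ IsIdempotentElem e ∧ ∀ x, x ∈ I ↔ x * e = x := by
  obtain ⟨e, he, h⟩ := exists_right_identity I
  obtain ⟨e', he', h'⟩ := exists_left_identity I
  obtain rfl : e' = e := (h e' he').symm.trans (h' e he)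
  refine ⟨e', fun x => ?_, h e' he', fun x => ⟨h x, fun hx => ?_⟩⟩
  · rw [← h' (x * e') (I.mul_mem_left _ _ he), ← mul_assoc, h (e' * x) (I.mul_mem_right _ _ he)]
  · rw [← hx]; exact I.mul_mem_left _ _ he

variable (F A : Type*) [Field F] [Ring A] [Algebra F A]

/-- The two-sided ideal `A e = {x | x e = x}` generated by a central idempotent `e`. -/
def idealOfCentralIdempotent (e : {e : Subalgebra.center F A // IsIdempotentElem e}) :
    TwoSidedIdeal A :=
  TwoSidedIdeal.mk' {x | x * (e.1 : A) = x} (by simp)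
    (fun {x y} hx hy => by
      simp only [Set.mem_ofPred_eq] at hx hy ⊢
      rw [add_mul, hx, hy])
    (fun {x} hx => by
      simp only [Set.mem_ofPred_eq] at hx ⊢
      rw [neg_mul, hx])
    (fun {x y} hy => by
      simp only [Set.mem_ofPred_eq] at hy ⊢
      rw [mul_assoc, hy])
    (fun {x y} hx => by
      simp only [Set.mem_ofPred_eq] at hx ⊢
      rw [mul_assoc, Subalgebra.mem_center_iff.mp e.1.2 y, ← mul_assoc, hx])

theorem mem_idealOfCentralIdempotent (e : {e : Subalgebra.center F A // IsIdempotentElem e})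
    (x : A) : x ∈ idealOfCentralIdempotent F A e ↔ x * (e.1 : A) = x :=
  TwoSidedIdeal.mem_mk' _ _ _ _ _ _ _

theorem idealOfCentralIdempotent_le_iff
    (e f : {e : Subalgebra.center F A // IsIdempotentElem e}) :
    idealOfCentralIdempotent F A e ≤ idealOfCentralIdempotent F A f ↔ e ≤ f := by
  have hef : e ≤ f ↔ (e.1 : A) * f.1 = e.1 := Subtype.ext_iff
  have hee : (e.1 : A) * e.1 = e.1 := congrArg Subtype.val e.2.eq
  rw [hef]
  constructor
  · intro h
    have := h ((mem_idealOfCentralIdempotent F A e _).mpr hee)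
    exact (mem_idealOfCentralIdempotent F A f _).mp this
  · intro h x hx
    have hx' := (mem_idealOfCentralIdempotent F A e x).mp hx
    refine (mem_idealOfCentralIdempotent F A f x).mpr ?_
    rw [← hx', mul_assoc, h]

theorem idealOfCentralIdempotent_surjective [IsSemisimpleRing A] :
    Function.Surjective (idealOfCentralIdempotent F A) := by
  intro I
  obtain ⟨e, hc, he, hI⟩ := exists_central_idempotent I
  refine ⟨⟨⟨e, Subalgebra.mem_center_iff.mpr hc⟩, Subtype.ext he⟩, ?_⟩
  refine TwoSidedIdeal.ext fun x => ?_
  rw [mem_idealOfCentralIdempotent, hI]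

/-- In a semisimple algebra the two-sided ideals correspond to the central idempotents. -/
noncomputable def centralIdempotentEquiv [IsSemisimpleRing A] :
    {e : Subalgebra.center F A // IsIdempotentElem e} ≃o TwoSidedIdeal A :=
  RelIso.ofSurjective
    (OrderEmbedding.ofMapLEIff (idealOfCentralIdempotent F A)
      (idealOfCentralIdempotent_le_iff F A))
    (idealOfCentralIdempotent_surjective F A)

/-- In a discrete space every set is clopen. -/
def clopensOrderIsoSet (X : Type*) [TopologicalSpace X] [DiscreteTopology X] :
    TopologicalSpace.Clopens X ≃o Set X where
  toFun s := s
  invFun s := ⟨s, isClopen_discrete s⟩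
  left_inv _ := rfl
  right_inv _ := rfl
  map_rel_iff' := Iff.rfl

/-- The simple components of a finite-dimensional semisimple algebra are counted by the points of
the spectrum of its center. -/
theorem numSimpleComponents_eq_card_primeSpectrum [IsSemisimpleRing A] [FiniteDimensional F A] :
    numSimpleComponents A = Nat.card (PrimeSpectrum (Subalgebra.center F A)) := by
  have : IsArtinianRing (Subalgebra.center F A) := IsArtinianRing.of_finite F _
  let X := PrimeSpectrum (Subalgebra.center F A)
  let φ : TwoSidedIdeal A ≃o Set X := (centralIdempotentEquiv F A).symm.trans
    (PrimeSpectrum.isIdempotentElemEquivClopens.trans (clopensOrderIsoSet X))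
  have himg : (φ : TwoSidedIdeal A → Set X) '' {I | IsAtom I} = Set.range (fun x : X => {x}) := by
    ext s
    constructor
    · rintro ⟨I, hI, rfl⟩
      obtain ⟨x, hx⟩ := Set.isAtom_iff.mp ((φ.isAtom_iff I).mpr hI)
      exact ⟨x, hx.symm⟩
    · rintro ⟨x, rfl⟩
      refine ⟨φ.symm {x}, ?_, φ.apply_symm_apply _⟩
      exact (φ.symm.isAtom_iff _).mpr (Set.isAtom_singleton x)
  rw [numSimpleComponents, ← Set.ncard_image_of_injective _ φ.injective, himg,
    ← Set.image_univ, Set.ncard_image_of_injective _ Set.singleton_injective, Set.ncard_univ]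

end SimpleComponents

/-! ### Extension of scalars -/

section CenterBaseChange

variable (K F B : Type*) [Field K] [Field F] [Algebra K F] [Ring B] [Algebra K B]

theorem center_tensor_eq_range :
    ((Subalgebra.center F (F ⊗[K] B)).restrictScalars K) =
      (Algebra.TensorProduct.map (AlgHom.id K F) (Subalgebra.center K B).val).range := by
  rw [← Subalgebra.centralizer_range_includeRight_eq_center_tensorProduct]
  ext z
  rw [Subalgebra.mem_restrictScalars, Subalgebra.mem_center_iff, Subalgebra.mem_centralizer_iff]
  constructor
  · rintro h _ ⟨b, rfl⟩
    exact h _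
  · intro h w
    induction w using TensorProduct.induction_on with
    | zero => simp
    | tmul x b =>
      have hb : (1 ⊗ₜ[K] b : F ⊗[K] B) * z = z * (1 ⊗ₜ[K] b) := h _ ⟨b, rfl⟩
      have hx : (x ⊗ₜ[K] b : F ⊗[K] B) = x • (1 ⊗ₜ[K] b) := by
        rw [TensorProduct.smul_tmul', smul_eq_mul, mul_one]
      rw [hx, smul_mul_assoc, mul_smul_comm, hb]
    | add y z hy hz => rw [add_mul, mul_add, hy, hz]

/-- Over a field, the formation of the center commutes with extension of scalars. -/
noncomputable def centerTensorEquiv :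
    F ⊗[K] Subalgebra.center K B ≃+* Subalgebra.center F (F ⊗[K] B) :=
  (AlgEquiv.ofInjective (Algebra.TensorProduct.map (AlgHom.id K F) (Subalgebra.center K B).val)
    (Module.Flat.lTensor_preserves_injective_linearMap (M := F)
      (Subalgebra.center K B).val.toLinearMap Subtype.val_injective)).toRingEquiv.trans
  (Subalgebra.equivOfEq _ _ (center_tensor_eq_range K F B).symm).toRingEquiv

end CenterBaseChange

theorem numSimpleComponents_congr {A B : Type*} [Ring A] [Ring B] (e : A ≃+* B) :
    numSimpleComponents A = numSimpleComponents B := by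
  have himg : (e.mapTwoSidedIdeal : TwoSidedIdeal A → TwoSidedIdeal B) '' {I | IsAtom I} =
      {I | IsAtom I} := by
    ext J
    constructor
    · rintro ⟨I, hI, rfl⟩
      exact (e.mapTwoSidedIdeal.isAtom_iff I).mpr hI
    · intro hJ
      exact ⟨e.mapTwoSidedIdeal.symm J, (e.mapTwoSidedIdeal.symm.isAtom_iff J).mpr hJ,
        e.mapTwoSidedIdeal.apply_symm_apply J⟩
  rw [numSimpleComponents, numSimpleComponents, ← himg,
    Set.ncard_image_of_injective _ e.mapTwoSidedIdeal.injective]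

/-- The canonical map `F ⊗ K[G] → F[G]`. -/
noncomputable def groupAlgebraBaseChangeHom (K F G : Type*) [Field K] [Field F]
    [Algebra K F] [Group G] : F ⊗[K] MonoidAlgebra K G →ₐ[F] MonoidAlgebra F G :=
  Algebra.TensorProduct.lift (Algebra.ofId F _)
    (MonoidAlgebra.lift K (MonoidAlgebra F G) G (MonoidAlgebra.of F G))
    fun x _ => Algebra.commutes x _

theorem groupAlgebraBaseChangeHom_tmul (K F G : Type*) [Field K] [Field F]
    [Algebra K F] [Group G] (x : F) (g : G) (c : K) :
    groupAlgebraBaseChangeHom K F G (x ⊗ₜ MonoidAlgebra.single g c) =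
      MonoidAlgebra.single g (c • x) := by
  refine (Algebra.TensorProduct.lift_tmul _ _ _ _ _).trans ?_
  rw [MonoidAlgebra.lift_single, MonoidAlgebra.of_apply, Algebra.ofId_apply,
    ← Algebra.smul_def, MonoidAlgebra.smul_single, MonoidAlgebra.smul_single, smul_eq_mul,
    mul_smul_comm, mul_one]

/-- Extension of scalars of a group algebra. -/
noncomputable def groupAlgebraBaseChange (K F G : Type*) [Field K] [Field F]
    [Algebra K F] [Group G] : F ⊗[K] MonoidAlgebra K G ≃ₐ[F] MonoidAlgebra F G := by
  refine AlgEquiv.ofBijective (groupAlgebraBaseChangeHom K F G) ?_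
  let g : MonoidAlgebra F G →ₗ[F] F ⊗[K] MonoidAlgebra K G :=
     (Finsupp.lift (F ⊗[K] MonoidAlgebra K G) F G
      fun g => 1 ⊗ₜ MonoidAlgebra.single g 1) ∘ₗ (MonoidAlgebra.coeffLinearEquiv F).toLinearMap
  have hg : ∀ x c, g (MonoidAlgebra.single x c) = c ⊗ₜ MonoidAlgebra.single x 1 := fun x c => by
    simp [g, TensorProduct.smul_tmul']
  refine Function.bijective_iff_has_inverse.mpr ⟨g, fun z => ?_, fun z => ?_⟩
  · induction z using TensorProduct.induction_on with
    | zero => simp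
    | add y z hy hz => rw [map_add, map_add, hy, hz]
    | tmul x b =>
      induction b using MonoidAlgebra.induction_linear with
      | zero => simp
      | add a b ha hb => rw [TensorProduct.tmul_add, map_add, map_add, ha, hb]
      | single y c =>
        rw [groupAlgebraBaseChangeHom_tmul, hg, TensorProduct.smul_tmul, MonoidAlgebra.smul_single,
          smul_eq_mul, mul_one]
  · induction z using MonoidAlgebra.induction_linear with
    | zero => simp
    | add y z hy hz => rw [map_add, map_add, hy, hz]
    | single x c => rw [hg, groupAlgebraBaseChangeHom_tmul, one_smul]

theorem numSimpleComponents_monoidAlgebra (K F G : Type*) [Field K] [CharZero K] [Field F]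
    [Algebra K F] [Group G] [Finite G] : numSimpleComponents (MonoidAlgebra F G) =
      Nat.card (PrimeSpectrum (F ⊗[K] Subalgebra.center K (MonoidAlgebra K G))) := by
  have : CharZero F := charZero_of_injective_algebraMap (algebraMap K F).injective
  let e : F ⊗[K] MonoidAlgebra K G ≃ₐ[F] MonoidAlgebra F G := groupAlgebraBaseChange K F G
  have : IsSemisimpleRing (MonoidAlgebra F G) := inferInstance
  have : IsSemisimpleRing (F ⊗[K] MonoidAlgebra K G) :=
    e.symm.toRingEquiv.isSemisimpleRing
  have : FiniteDimensional F (F ⊗[K] MonoidAlgebra K G) := inferInstance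
  rw [← numSimpleComponents_congr e.toRingEquiv, numSimpleComponents_eq_card_primeSpectrum F]
  exact Nat.card_congr
    (PrimeSpectrum.comapEquiv (centerTensorEquiv K F (MonoidAlgebra K G))).toEquiv.symm

/-! ### Residue fields and homomorphisms to `ℂ` -/

theorem isField_iff_subsingleton_primeSpectrum (R : Type*) [CommRing R] [Nontrivial R]
    [IsArtinianRing R] [IsReduced R] : IsField R ↔ Subsingleton (PrimeSpectrum R) := by
  constructor
  · intro h
    let := h.toField
    exact inferInstance
  · intro h
    obtain ⟨M, hM⟩ := Ideal.exists_maximal R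
    have : IsLocalRing R := IsLocalRing.of_unique_max_ideal ⟨M, hM, fun N hN =>
      congrArg PrimeSpectrum.asIdeal (Subsingleton.elim (α := PrimeSpectrum R)
        ⟨N, hN.isPrime⟩ ⟨M, hM.isPrime⟩)⟩
    exact IsArtinianRing.isField_of_isReduced_of_isLocalRing R

theorem isField_tensor_iff_subsingleton_primeSpectrum (K L F : Type*) [Field K] [Field L]
    [Field F] [Algebra K L] [Algebra K F] [FiniteDimensional K F] [Algebra.IsSeparable K F] :
    IsField (L ⊗[K] F) ↔ Subsingleton (PrimeSpectrum (L ⊗[K] F)) := by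
  have : Algebra.FormallyUnramified K F := Algebra.FormallyUnramified.of_isSeparable K F
  have : Algebra.FormallyUnramified L (L ⊗[K] F) := Algebra.FormallyUnramified.base_change L
  have : IsReduced (L ⊗[K] F) := Algebra.FormallyUnramified.isReduced_of_field L _
  have : IsArtinianRing (L ⊗[K] F) := IsArtinianRing.of_finite L _
  exact isField_iff_subsingleton_primeSpectrum _

/-- Extending scalars along a finite separable extension `F / K` keeps the number of points of the
spectrum of a finite `K`-algebra exactly when no residue field splits over `F`. -/
theorem card_primeSpectrum_tensor_eq_iff_isField (K S F : Type*) [Field K] [CommRing S]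
    [Algebra K S] [FiniteDimensional K S] [Field F] [Algebra K F] [FiniteDimensional K F]
    [Algebra.IsSeparable K F] :
    Nat.card (PrimeSpectrum (F ⊗[K] S)) = Nat.card (PrimeSpectrum S) ↔
      ∀ p : PrimeSpectrum S, IsField (p.asIdeal.ResidueField ⊗[K] F) := by
  have : IsArtinianRing S := IsArtinianRing.of_finite K _
  have : IsArtinianRing (S ⊗[K] F) := IsArtinianRing.of_finite K _
  rw [Nat.card_congr (PrimeSpectrum.comapEquiv
    (Algebra.TensorProduct.comm K F S).toRingEquiv).toEquiv]
  let f := PrimeSpectrum.comap (algebraMap S (S ⊗[K] F))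
  have hf : Function.Surjective f := PrimeSpectrum.comap_surjective_of_faithfullyFlat
  have h1 : Nat.card (PrimeSpectrum (S ⊗[K] F)) = Nat.card (PrimeSpectrum S) ↔
      Function.Injective f :=
    ⟨fun h => (hf.bijective_of_nat_card_le h.le).injective,
      fun h => Nat.card_congr (Equiv.ofBijective f ⟨h, hf⟩)⟩
  have h2 : Function.Injective f ↔ ∀ p, Subsingleton (f ⁻¹' {p}) := by
    constructor
    · rintro h p
      exact ⟨fun x y => Subtype.ext (h (x.2.trans y.2.symm))⟩
    · intro h x y hxy
      exact congrArg Subtype.val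
        ((h (f y)).elim (⟨x, hxy⟩ : f ⁻¹' {f y}) ⟨y, rfl⟩)
  rw [h1, h2]
  refine forall_congr' fun p => ?_
  rw [isField_tensor_iff_subsingleton_primeSpectrum,
    (PrimeSpectrum.preimageEquivFiber S (S ⊗[K] F) p).subsingleton_congr]
  exact (PrimeSpectrum.comapEquiv (Algebra.TensorProduct.cancelBaseChange K S
    p.asIdeal.ResidueField p.asIdeal.ResidueField F).toRingEquiv).toEquiv.subsingleton_congr

section

variable {K S E : Type*} [Field K] [CommRing S] [Algebra K S] [Field E] [Algebra K E]

/-- Every point of the spectrum of a finite algebra is the kernel of a homomorphism into an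
algebraically closed field, whose image generates a copy of the residue field. -/
theorem exists_algHom_fieldRange_residueField [IsAlgClosed E] [FiniteDimensional K S]
    (p : PrimeSpectrum S) :
    ∃ (φ : S →ₐ[K] E) (ψ : p.asIdeal.ResidueField →ₐ[K] E),
      ψ.fieldRange = IntermediateField.adjoin K (Set.range φ) := by
  have : IsArtinianRing S := IsArtinianRing.of_finite K _
  have : p.asIdeal.IsMaximal := inferInstance
  have hsurj := Ideal.algebraMap_residueField_surjective p.asIdeal
  let g : S →ₐ[K] p.asIdeal.ResidueField := IsScalarTower.toAlgHom K S _
  have : FiniteDimensional K p.asIdeal.ResidueField :=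
    Module.Finite.of_surjective g.toLinearMap hsurj
  let ψ : p.asIdeal.ResidueField →ₐ[K] E := IsAlgClosed.lift
  refine ⟨ψ.comp g, ψ, le_antisymm ?_ ?_⟩
  · rintro _ ⟨x, rfl⟩
    obtain ⟨s, rfl⟩ := hsurj x
    exact IntermediateField.subset_adjoin _ _ ⟨s, rfl⟩
  · rw [IntermediateField.adjoin_le_iff]
    rintro _ ⟨s, rfl⟩
    exact ⟨g s, rfl⟩

theorem exists_residueField_algHom [FiniteDimensional K S] (φ : S →ₐ[K] E) :
    ∃ (p : PrimeSpectrum S) (ψ : p.asIdeal.ResidueField →ₐ[K] E),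
      ψ.fieldRange = IntermediateField.adjoin K (Set.range φ) := by
  have : IsArtinianRing S := IsArtinianRing.of_finite K _
  obtain ⟨p, hp⟩ : ∃ p : PrimeSpectrum S, p.asIdeal = RingHom.ker φ :=
    ⟨⟨RingHom.ker φ, RingHom.ker_isPrime _⟩, rfl⟩
  have : p.asIdeal.IsMaximal := inferInstance
  have hsurj := Ideal.algebraMap_residueField_surjective p.asIdeal
  have hunit : p.asIdeal.primeCompl ≤ (IsUnit.submonoid E).comap φ := fun x hx => by
    have hx0 : φ x ≠ 0 := fun h => hx (hp ▸ RingHom.mem_ker.mpr h)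
    exact hx0.isUnit
  let ψ : p.asIdeal.ResidueField →ₐ[K] E := Ideal.ResidueField.liftₐ p.asIdeal φ hp.le hunit
  have hψ : ∀ s, ψ (algebraMap S _ s) = φ s :=
    Ideal.ResidueField.liftₐ_algebraMap p.asIdeal φ hp.le hunit
  refine ⟨p, ψ, le_antisymm ?_ ?_⟩
  · rintro _ ⟨x, rfl⟩
    obtain ⟨s, rfl⟩ := hsurj x
    exact IntermediateField.subset_adjoin _ _ ⟨s, (hψ s).symm⟩
  · rw [IntermediateField.adjoin_le_iff]
    rintro _ ⟨s, rfl⟩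
    exact ⟨_, hψ s⟩

/-- For a Galois image, meeting `F` in the ground field is the same as linear disjointness. -/
theorem isField_tensor_iff_inf_eq_bot {L F : Type*} [Field L] [Algebra K L] [Field F]
    [Algebra K F] [FiniteDimensional K F] (ψ : L →ₐ[K] E) (ι : F →ₐ[K] E)
    [FiniteDimensional K ψ.fieldRange] [IsGalois K ψ.fieldRange] :
    IsField (L ⊗[K] F) ↔ ψ.fieldRange ⊓ ι.fieldRange = ⊥ := by
  have : FiniteDimensional K ι.fieldRange :=
    (AlgEquiv.ofInjectiveField ι).toLinearEquiv.finiteDimensional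
  rw [← IntermediateField.LinearDisjoint.iff_inf_eq_bot]
  constructor
  · intro h
    exact IntermediateField.LinearDisjoint.of_isField' h ψ ι
  · intro h
    exact h.isField_of_isAlgebraic' (Or.inr inferInstance)

/-- If all homomorphisms from a finite algebra `S` into `E` have Galois image, then `Spec S` gains
no points over `F` exactly when each of these images meets `F` in the ground field. -/
theorem card_primeSpectrum_tensor_eq_iff [IsAlgClosed E] [FiniteDimensional K S]
    {F : Type*} [Field F] [Algebra K F] [FiniteDimensional K F] [Algebra.IsSeparable K F]
    (ι : F →ₐ[K] E)
    (hfin : ∀ φ : S →ₐ[K] E, FiniteDimensional K (IntermediateField.adjoin K (Set.range φ)))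
    (hgal : ∀ φ : S →ₐ[K] E, IsGalois K (IntermediateField.adjoin K (Set.range φ))) :
    Nat.card (PrimeSpectrum (F ⊗[K] S)) = Nat.card (PrimeSpectrum S) ↔
      ∀ φ : S →ₐ[K] E, IntermediateField.adjoin K (Set.range φ) ⊓ ι.fieldRange = ⊥ := by
  rw [card_primeSpectrum_tensor_eq_iff_isField]
  constructor
  · intro h φ
    obtain ⟨p, ψ, hψ⟩ := exists_residueField_algHom φ
    have := hfin φ
    have := hgal φ
    rw [← hψ] at *
    exact (isField_tensor_iff_inf_eq_bot ψ ι).mp (h p)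
  · intro h p
    obtain ⟨φ, ψ, hψ⟩ := exists_algHom_fieldRange_residueField (K := K) (E := E) p
    have := hfin φ
    have := hgal φ
    have := h φ
    rw [← hψ] at *
    exact (isField_tensor_iff_inf_eq_bot ψ ι).mpr this

end

/-- The simple components of `FG` are minimal in number exactly when, for each homomorphism from
the center of `ℚG` to `ℂ`, the image meets `F` in `ℚ`. -/
theorem hasMinimalComponents_iff {F : Type*} [Field F] [NumberField F] (ι : F →ₐ[ℚ] ℂ)
    {G : Type*} [Group G] [Finite G]
    (hfin : ∀ φ : Subalgebra.center ℚ (MonoidAlgebra ℚ G) →ₐ[ℚ] ℂ,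
      FiniteDimensional ℚ (IntermediateField.adjoin ℚ (Set.range φ)))
    (hgal : ∀ φ : Subalgebra.center ℚ (MonoidAlgebra ℚ G) →ₐ[ℚ] ℂ,
      IsGalois ℚ (IntermediateField.adjoin ℚ (Set.range φ))) :
    HasMinimalComponents F G ↔
      ∀ φ : Subalgebra.center ℚ (MonoidAlgebra ℚ G) →ₐ[ℚ] ℂ,
        IntermediateField.adjoin ℚ (Set.range φ) ⊓ ι.fieldRange = ⊥ := by
  have : FiniteDimensional ℚ (Subalgebra.center ℚ (MonoidAlgebra ℚ G)) := inferInstance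
  have : FiniteDimensional ℚ F := inferInstance
  rw [HasMinimalComponents, numSimpleComponents_monoidAlgebra ℚ F G,
    numSimpleComponents_eq_card_primeSpectrum ℚ (MonoidAlgebra ℚ G)]
  exact card_primeSpectrum_tensor_eq_iff ι hfin hgal

/-! ### Generators of the metacyclic group -/

section SplitGenerators

variable {G : Type*} [Group G]

theorem zpow_mul_pow_eq {a b : G} {r : ℤ} (hab : b⁻¹ * a * b = a ^ r) (i : ℤ) (j : ℕ) :
    a ^ i * b ^ j = b ^ j * a ^ (i * r ^ j) := by
  induction j generalizing i with
  | zero => simp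
  | succ j ih =>
    have h1 : ∀ x : ℤ, a ^ x * b = b * a ^ (r * x) := fun x => by
      rw [zpow_mul, ← hab]
      have := conj_zpow (i := x) (a := b⁻¹) (b := a)
      rw [inv_inv] at this
      rw [this]; group
    rw [pow_succ, ← mul_assoc, ih, mul_assoc, h1, ← mul_assoc]
    congr 2
    ring

theorem zpow_eq_zpow_of_dvd {a : G} {q : ℕ} (ha : a ^ q = 1) {x y : ℤ} (h : (q : ℤ) ∣ x - y) :
    a ^ x = a ^ y := by
  obtain ⟨c, hc⟩ := h
  rw [show x = q * c + y by linarith, zpow_add, zpow_mul, zpow_natCast, ha, one_zpow, one_mul]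

theorem mul_zpow_pow_eq {a b : G} {q n : ℕ} {r s : ℤ} (ha : a ^ q = 1)
    (hab : b⁻¹ * a * b = a ^ r) (hs : (q : ℤ) ∣ s * (r - 1)) :
    (b * a ^ s) ^ n = b ^ n * a ^ (s * n) := by
  have hc : Commute b (a ^ s) := by
    have h := zpow_mul_pow_eq hab s 1
    rw [pow_one, pow_one, zpow_eq_zpow_of_dvd ha
      (show (q : ℤ) ∣ s * r - s by rwa [mul_sub, mul_one] at hs)] at h
    exact h.symm
  rw [hc.mul_pow, ← zpow_natCast (a ^ s), ← zpow_mul]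

/-- In the metacyclic group the second generator can be corrected by a power of the first so that
its `n`-th power is trivial: the extension of `⟨b⟩ / ⟨b ^ n⟩` by `⟨a⟩` splits because `q` does not
divide `n`. The new generators satisfy the defining relations of the split group, and the group has
the corresponding universal property. -/
theorem exists_split_generators {q n : ℕ} {t r : ℤ} (hq : q.Prime) (hqn : ¬ q ∣ n)
    (ht : (q : ℤ) ∣ t * (r - 1)) :
    ∃ a b : MetacyclicGroup q n t r, a ^ q = 1 ∧ b ^ n = 1 ∧ b⁻¹ * a * b = a ^ r ∧
      (∀ g, ∃ (j : ℕ) (i : ℤ), g = b ^ j * a ^ i) ∧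
      ∀ (H : Type) [Group H] (α β : H), α ^ q = 1 → β ^ n = 1 → β⁻¹ * α * β = α ^ r →
        ∃ f : MetacyclicGroup q n t r →* H, f a = α ∧ f b = β := by
  have hcop : IsCoprime (n : ℤ) q :=
    Nat.isCoprime_iff_coprime.mpr ((Nat.Prime.coprime_iff_not_dvd hq).mpr hqn).symm
  obtain ⟨u, v, huv⟩ := hcop
  set s : ℤ := t * u with hs
  have hsn : (q : ℤ) ∣ s * n - t := ⟨-(t * v), by rw [hs]; linear_combination t * huv⟩
  have hsr : (q : ℤ) ∣ s * (r - 1) := by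
    obtain ⟨c, hc⟩ := ht
    exact ⟨u * c, by rw [hs]; linear_combination u * hc⟩
  let a : MetacyclicGroup q n t r := PresentedGroup.of true
  let b₀ : MetacyclicGroup q n t r := PresentedGroup.of false
  have hrel : ∀ w ∈ metacyclicRels q n t r, PresentedGroup.mk (metacyclicRels q n t r) w = 1 :=
    fun w hw => (PresentedGroup.mk_eq_one_iff).mpr (Subgroup.subset_normalClosure hw)
  have ha : a ^ q = 1 := by
    have := hrel (FreeGroup.of true ^ q) (by simp [metacyclicRels])
    rwa [map_pow] at this
  have hb₀ : b₀ ^ n = a ^ t := by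
    have := hrel (FreeGroup.of false ^ n * (FreeGroup.of true ^ t)⁻¹) (by simp [metacyclicRels])
    rw [map_mul, map_pow, map_inv, map_zpow, mul_inv_eq_one] at this
    exact this
  have hab₀ : b₀⁻¹ * a * b₀ = a ^ r := by
    have := hrel ((FreeGroup.of false)⁻¹ * FreeGroup.of true * FreeGroup.of false *
      (FreeGroup.of true ^ r)⁻¹) (by simp [metacyclicRels])
    rw [map_mul, map_mul, map_mul, map_inv, map_inv, map_zpow, mul_inv_eq_one] at this
    exact this
  let b := b₀ * a ^ (-s)
  have hb : b ^ n = 1 := by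
    rw [mul_zpow_pow_eq ha hab₀ (by rw [neg_mul]; exact hsr.neg_right), hb₀, ← zpow_add,
      zpow_eq_zpow_of_dvd ha (y := 0) ?_, zpow_zero]
    rw [show t + -s * n - 0 = -(s * n - t) by ring]
    exact hsn.neg_right
  have hab : b⁻¹ * a * b = a ^ r := by
    have : b⁻¹ * a * b = a ^ s * (b₀⁻¹ * a * b₀) * a ^ (-s) := by
      simp only [b]; group
    rw [this, hab₀, ← zpow_add, ← zpow_add]
    congr 1; ring
  refine ⟨a, b, ha, hb, hab, ?_, ?_⟩
  · -- the elements that preserve the set of normal forms under left multiplication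
    let K : Subgroup (MetacyclicGroup q n t r) :=
      { carrier := {g | ∀ x, (∃ (j : ℕ) (i : ℤ), x = b ^ j * a ^ i) →
          (∃ (j : ℕ) (i : ℤ), g * x = b ^ j * a ^ i) ∧
          ∃ (j : ℕ) (i : ℤ), g⁻¹ * x = b ^ j * a ^ i}
        one_mem' := fun x hx => by simpa using hx
        mul_mem' := fun {g h} hg hh x hx => by
          rw [mul_assoc, mul_inv_rev, mul_assoc]
          exact ⟨(hg _ (hh x hx).1).1, (hh _ (hg x hx).2).2⟩
        inv_mem' := fun {g} hg x hx => by
          rw [inv_inv]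
          exact (hg x hx).symm }
    have haK : ∀ y : ℤ, a ^ y ∈ K := by
      rintro y _ ⟨j, i, rfl⟩
      refine ⟨⟨j, y * r ^ j + i, ?_⟩, ⟨j, -y * r ^ j + i, ?_⟩⟩
      · rw [← mul_assoc, zpow_mul_pow_eq hab, mul_assoc, ← zpow_add]
      · rw [← zpow_neg, ← mul_assoc, zpow_mul_pow_eq hab, mul_assoc, ← zpow_add]
    have hn0 : n ≠ 0 := by rintro rfl; exact hqn (dvd_zero q)
    have hbK : b ∈ K := by
      rintro _ ⟨j, i, rfl⟩
      refine ⟨⟨j + 1, i, ?_⟩, ⟨n - 1 + j, i, ?_⟩⟩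
      · rw [← mul_assoc, pow_succ']
      · have : b⁻¹ = b ^ (n - 1) := by
          rw [inv_eq_iff_mul_eq_one, ← pow_succ', Nat.sub_add_cancel (Nat.pos_of_ne_zero hn0), hb]
        rw [this, ← mul_assoc, pow_add]
    have hb₀K : b₀ ∈ K := by
      have : b₀ = b * a ^ s := by simp only [b]; group
      rw [this]; exact K.mul_mem hbK (haK s)
    have hK : K = ⊤ := by
      rw [eq_top_iff, ← PresentedGroup.closure_range_of, Subgroup.closure_le]
      rintro _ ⟨x, rfl⟩
      cases x
      · exact hb₀K
      · simpa using haK 1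
    intro g
    have hg : g ∈ K := hK ▸ Subgroup.mem_top g
    simpa using (hg 1 ⟨0, 0, by simp⟩).1
  · intro H _ α β hα hβ hαβ
    let c : Bool → H := fun x => cond x α (β * α ^ s)
    have hc : ∀ w ∈ metacyclicRels q n t r, FreeGroup.lift c w = 1 := by
      rintro w (rfl | rfl | rfl)
      · simp [c, hα]
      · simp only [map_mul, map_pow, map_inv, map_zpow, FreeGroup.lift_apply_of, c, cond_true,
          cond_false]
        rw [mul_zpow_pow_eq hα hαβ hsr, hβ, one_mul, zpow_eq_zpow_of_dvd hα hsn, mul_inv_cancel]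
      · simp only [map_mul, map_inv, map_zpow, FreeGroup.lift_apply_of, c, cond_true, cond_false]
        have : (β * α ^ s)⁻¹ * α * (β * α ^ s) = α ^ (-s) * (β⁻¹ * α * β) * α ^ s := by group
        rw [this, hαβ, ← zpow_add, ← zpow_add, ← zpow_neg, ← zpow_add]
        simp
    refine ⟨PresentedGroup.toGroup hc, PresentedGroup.toGroup.of hc, ?_⟩
    have h1 : PresentedGroup.toGroup hc a = α := PresentedGroup.toGroup.of hc
    have h2 : PresentedGroup.toGroup hc b₀ = β * α ^ s := PresentedGroup.toGroup.of hc
    rw [map_mul, map_zpow, h1, h2]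
    group

theorem finite_of_split_generators {a b : G} {q n : ℕ} (hq : q ≠ 0) (hn : n ≠ 0) (ha : a ^ q = 1)
    (hb : b ^ n = 1) (hg : ∀ g : G, ∃ (j : ℕ) (i : ℤ), g = b ^ j * a ^ i) : Finite G := by
  have hA : (Subgroup.zpowers a : Set G).Finite := by
    have : IsOfFinOrder a := isOfFinOrder_iff_pow_eq_one.mpr ⟨q, Nat.pos_of_ne_zero hq, ha⟩
    exact this.finite_zpowers
  have hB : (Subgroup.zpowers b : Set G).Finite := by
    have : IsOfFinOrder b := isOfFinOrder_iff_pow_eq_one.mpr ⟨n, Nat.pos_of_ne_zero hn, hb⟩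
    exact this.finite_zpowers
  refine Set.finite_univ_iff.mp ((Set.Finite.image2 (fun x y => x * y) hB hA).subset ?_)
  intro g _
  obtain ⟨j, i, rfl⟩ := hg g
  exact ⟨b ^ j, ⟨j, zpow_natCast b j⟩, a ^ i, ⟨i, rfl⟩, rfl⟩

end SplitGenerators

/-! ### The fixed field of `b` -/

theorem sum_range_shift {M : Type*} [AddCommMonoid M] (f : ℕ → M) {m : ℕ} (h : f m = f 0) :
    ∑ l ∈ Finset.range m, f (l + 1) = ∑ l ∈ Finset.range m, f l := by
  rcases m with _ | m
  · simp
  · rw [Finset.sum_range_succ, h, ← Finset.sum_range_succ']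

theorem dvd_pow_orderOf_sub_one {q m : ℕ} {r : ℤ} (hr : orderOf (r : ZMod q) = m) :
    (q : ℤ) ∣ r ^ m - 1 := by
  rw [← ZMod.intCast_zmod_eq_zero_iff_dvd, Int.cast_sub, Int.cast_pow, ← hr, pow_orderOf_eq_one]
  simp

theorem dvd_pow_sub_one_iff {q m : ℕ} {r : ℤ} (hr : orderOf (r : ZMod q) = m) (j : ℕ) :
    (q : ℤ) ∣ r ^ j - 1 ↔ m ∣ j := by
  rw [← ZMod.intCast_zmod_eq_zero_iff_dvd, Int.cast_sub, Int.cast_pow, ← hr,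
    orderOf_dvd_iff_pow_eq_one, Int.cast_one, sub_eq_zero]

theorem isCoprime_of_orderOf {q m : ℕ} {r : ℤ} (hm : m ≠ 0) (hr : orderOf (r : ZMod q) = m) :
    IsCoprime r q := by
  obtain ⟨c, hc⟩ := dvd_pow_orderOf_sub_one hr
  obtain ⟨m, rfl⟩ := Nat.exists_eq_succ_of_ne_zero hm
  exact ⟨r ^ m, -c, by rw [pow_succ] at hc; linear_combination hc⟩

theorem coe_zpow_cyclo {N : ℕ} (z : cyclo N) (i : ℤ) : ((z ^ i : cyclo N) : ℂ) = (z : ℂ) ^ i :=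
  map_zpow₀ (cyclo N).val z i

section FixedField

/-- The trace `∑ σ ^ l (ζ_k ^ y ζ_q ^ x)`, over `l < m`, of a root of unity, where `σ` is the
automorphism through which `b` acts. -/
noncomputable def zetaTrace (q k m : ℕ) (r x y : ℤ) : ℂ :=
  ∑ l ∈ Finset.range m, zeta k ^ y * zeta q ^ (x * r ^ l)

variable {q k m : ℕ} {r : ℤ}

theorem zeta_pow_self (hq : q ≠ 0) : zeta q ^ q = 1 := (zeta_isPrimitiveRoot hq).pow_eq_one

theorem zeta_ne_zero (q : ℕ) : zeta q ≠ 0 := Complex.exp_ne_zero _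

theorem zeta_zpow_congr (hq : q ≠ 0) {x y : ℤ} (h : (q : ℤ) ∣ x - y) :
    zeta q ^ x = zeta q ^ y := by
  obtain ⟨c, hc⟩ := h
  rw [show x = q * c + y by linarith, zpow_add₀ (zeta_ne_zero q), zpow_mul, zpow_natCast,
    zeta_pow_self hq, one_zpow, one_mul]

/-- An automorphism in `bAut` acts on `ζ_k ^ y ζ_q ^ x` by raising `ζ_q` to the power `r`. -/
theorem bAut_pow_apply (hq : q ≠ 0) (hk : k ≠ 0) {σ : cyclo (q * k) ≃ₐ[ℚ] cyclo (q * k)}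
    (hσ : σ ∈ bAut q k r) {z : cyclo (q * k)} {x y : ℤ}
    (hz : (z : ℂ) = zeta k ^ y * zeta q ^ x) (l : ℕ) :
    ((σ ^ l) z : ℂ) = zeta k ^ y * zeta q ^ (x * r ^ l) := by
  have hz' : z = (zetaGen (q * k) ^ q) ^ y * (zetaGen (q * k) ^ k) ^ x := by
    apply Subtype.ext
    rw [hz, IntermediateField.coe_mul, coe_zpow_cyclo, coe_zpow_cyclo,
      coe_zetaGen_pow_left q hk, coe_zetaGen_pow_right hq k]
  have key : (σ ^ l) z =
      (zetaGen (q * k) ^ q) ^ y * (zetaGen (q * k) ^ k) ^ (x * r ^ l) := by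
    induction l with
    | zero => simp [hz']
    | succ l ih =>
      rw [pow_succ', AlgEquiv.mul_apply, ih, map_mul, map_zpow₀, map_zpow₀, hσ.1, hσ.2,
        ← zpow_mul]
      congr 2
      ring
  rw [key, IntermediateField.coe_mul, coe_zpow_cyclo, coe_zpow_cyclo,
    coe_zetaGen_pow_left q hk, coe_zetaGen_pow_right hq k]

theorem zetaTrace_mem_bFixed (hq : q ≠ 0) (hk : k ≠ 0) (hr : orderOf (r : ZMod q) = m)
    (x y : ℤ) : zetaTrace q k m r x y ∈ bFixed q k r := by
  let z : ℕ → cyclo (q * k) := fun l =>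
    (zetaGen (q * k) ^ q) ^ y * (zetaGen (q * k) ^ k) ^ (x * r ^ l)
  have hz : ∀ l, (z l : ℂ) = zeta k ^ y * zeta q ^ (x * r ^ l) := fun l => by
    rw [IntermediateField.coe_mul, coe_zpow_cyclo, coe_zpow_cyclo,
      coe_zetaGen_pow_left q hk, coe_zetaGen_pow_right hq k]
  have hper : z m = z 0 := by
    apply Subtype.ext
    rw [hz, hz]
    congr 1
    refine zeta_zpow_congr hq ?_
    rw [pow_zero, ← mul_sub]
    exact (dvd_pow_orderOf_sub_one hr).mul_left x
  have hfix : ∀ σ ∈ Subgroup.closure (bAut q k r),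
      σ (∑ l ∈ Finset.range m, z l) = ∑ l ∈ Finset.range m, z l := by
    intro σ hσ
    induction hσ using Subgroup.closure_induction with
    | mem σ hσ =>
      rw [map_sum, ← sum_range_shift z hper]
      refine Finset.sum_congr rfl fun l _ => Subtype.ext ?_
      have := bAut_pow_apply hq hk hσ (hz l) 1
      rw [pow_one] at this
      rw [this, hz]
      congr 2
      ring
    | one => rfl
    | mul σ τ _ _ h1 h2 => rw [AlgEquiv.mul_apply, h2, h1]
    | inv σ _ h => conv_lhs => rw [← h, ← AlgEquiv.mul_apply, inv_mul_cancel, AlgEquiv.one_apply]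
  have hsum : ((∑ l ∈ Finset.range m, z l : cyclo (q * k)) : ℂ) = zetaTrace q k m r x y := by
    rw [zetaTrace, AddSubmonoidClass.coe_finsetSum]
    exact Finset.sum_congr rfl fun l _ => hz l
  rw [← hsum]
  exact (IntermediateField.mem_lift _).mpr ((IntermediateField.mem_fixedField_iff _ _).mpr hfix)

theorem exists_zeta_eq (hq : q ≠ 0) (hk : k ≠ 0) (hqk : q.Coprime k) :
    ∃ x y : ℤ, zeta (q * k) = zeta k ^ y * zeta q ^ x := by
  obtain ⟨y, x, hxy⟩ := Nat.isCoprime_iff_coprime.mpr hqk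
  refine ⟨x, y, ?_⟩
  have h1 := coe_zetaGen_pow_left q hk
  have h2 := coe_zetaGen_pow_right hq k
  rw [IntermediateField.coe_pow, coe_zetaGen] at h1 h2
  rw [← h1, ← h2, ← zpow_natCast, ← zpow_natCast, ← zpow_mul, ← zpow_mul,
    ← zpow_add₀ (zeta_ne_zero _), show (q : ℤ) * y + k * x = 1 by linear_combination hxy, zpow_one]

/-- The field `ℚ(ζ_qk)^⟨b⟩` is generated by the traces of the roots of unity. -/
theorem bFixed_le_of_zetaTrace_mem (hq : q ≠ 0) (hk : k ≠ 0) (hm : m ≠ 0) (hqk : q.Coprime k)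
    (hr : orderOf (r : ZMod q) = m) (E : IntermediateField ℚ ℂ)
    (hE : ∀ x y : ℤ, zetaTrace q k m r x y ∈ E) : bFixed q k r ≤ E := by
  obtain ⟨σ, hσ, -⟩ := existsUnique_bAut hq hk hqk (isCoprime_of_orderOf hm hr)
  obtain ⟨x, y, hxy⟩ := exists_zeta_eq hq hk hqk
  have hint : IsIntegral ℚ (zeta (q * k)) :=
    ((zeta_isPrimitiveRoot (mul_ne_zero hq hk)).isIntegral
      (Nat.pos_of_ne_zero (mul_ne_zero hq hk))).tower_top
  have htr : ∀ p : Polynomial ℚ, ∀ z : cyclo (q * k), (z : ℂ) = Polynomial.aeval (zeta (q * k)) p →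
      ∑ l ∈ Finset.range m, ((σ ^ l) z : ℂ) ∈ E := by
    intro p
    induction p using Polynomial.induction_on' with
    | add p p' hp hp' =>
      intro z hz
      let z₁ : cyclo (q * k) := Polynomial.aeval (zetaGen (q * k)) p
      let z₂ : cyclo (q * k) := Polynomial.aeval (zetaGen (q * k)) p'
      have h1 : (z₁ : ℂ) = Polynomial.aeval (zeta (q * k)) p :=
        (Polynomial.aeval_algHom_apply (cyclo (q * k)).val (zetaGen (q * k)) p).symm
      have h2 : (z₂ : ℂ) = Polynomial.aeval (zeta (q * k)) p' :=
        (Polynomial.aeval_algHom_apply (cyclo (q * k)).val (zetaGen (q * k)) p').symm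
      have : z = z₁ + z₂ := Subtype.ext (by
        rw [hz, map_add, IntermediateField.coe_add, h1, h2])
      simp only [this, map_add, IntermediateField.coe_add, Finset.sum_add_distrib]
      exact E.add_mem (hp _ h1) (hp' _ h2)
    | monomial N c =>
      intro z hz
      have hz' : z = (c : cyclo (q * k)) * (zetaGen (q * k)) ^ N := Subtype.ext (by
        rw [hz, Polynomial.aeval_monomial, eq_ratCast, IntermediateField.coe_mul,
          IntermediateField.coe_pow, coe_zetaGen]
        rfl)
      have hg : ((zetaGen (q * k) ^ N : cyclo (q * k)) : ℂ) =
          zeta k ^ (y * N) * zeta q ^ (x * N) := by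
        rw [IntermediateField.coe_pow, coe_zetaGen, hxy, mul_pow, zpow_mul, zpow_mul,
          zpow_natCast, zpow_natCast]
      have : ∑ l ∈ Finset.range m, ((σ ^ l) z : ℂ) =
          (c : ℂ) * zetaTrace q k m r (x * N) (y * N) := by
        rw [zetaTrace, Finset.mul_sum]
        refine Finset.sum_congr rfl fun l _ => ?_
        rw [hz', map_mul, map_ratCast, IntermediateField.coe_mul, bAut_pow_apply hq hk hσ hg]
        rfl
      rw [this]
      exact E.mul_mem (SubfieldClass.ratCast_mem E c) (hE _ _)
  intro w hw
  obtain ⟨z, hz, rfl⟩ := hw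
  obtain ⟨p, hp⟩ : ∃ p : Polynomial ℚ, Polynomial.aeval (zeta (q * k)) p = (z : ℂ) := by
    have h := z.2
    rw [← IntermediateField.mem_toSubalgebra,
      IntermediateField.adjoin_simple_toSubalgebra_of_isAlgebraic hint.isAlgebraic,
      Algebra.adjoin_singleton_eq_range_aeval] at h
    exact h
  have hσz : ∀ l : ℕ, (σ ^ l) z = z := fun l =>
    (IntermediateField.mem_fixedField_iff _ _).mp hz _
      (Subgroup.pow_mem _ (Subgroup.subset_closure hσ) l)
  have h := htr p z hp.symm
  simp only [hσz, Finset.sum_const, Finset.card_range, nsmul_eq_mul] at h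
  have hm' : (m : ℂ) ≠ 0 := Nat.cast_ne_zero.mpr hm
  have := E.mul_mem (E.inv_mem (natCast_mem E m)) h
  rwa [inv_mul_cancel_left₀ hm'] at this

theorem cyclo_le_of_zeta_mem {n : ℕ} {E : IntermediateField ℚ ℂ} (h : zeta n ∈ E) : cyclo n ≤ E :=
  IntermediateField.adjoin_simple_le_iff.mpr h

theorem mem_cyclo_of_pow_eq_one {n : ℕ} (hn : n ≠ 0) {w : ℂ} (hw : w ^ n = 1) : w ∈ cyclo n := by
  have : NeZero n := ⟨hn⟩
  obtain ⟨i, -, rfl⟩ := (zeta_isPrimitiveRoot hn).eq_pow_of_pow_eq_one hw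
  exact pow_mem (zetaGen n).2 i

theorem isCyclotomicExtension_cyclo {n : ℕ} (hn : n ≠ 0) :
    IsCyclotomicExtension {n} ℚ (cyclo n) := by
  have : NeZero n := ⟨hn⟩
  exact (IntermediateField.isCyclotomicExtension_singleton_iff_eq_adjoin _ _ _ _
    (zeta_isPrimitiveRoot hn)).mpr rfl

theorem finiteDimensional_cyclo {n : ℕ} (hn : n ≠ 0) : FiniteDimensional ℚ (cyclo n) := by
  have := isCyclotomicExtension_cyclo hn
  exact IsCyclotomicExtension.finiteDimensional {n} ℚ _

theorem isAbelianGalois_cyclo {n : ℕ} (hn : n ≠ 0) : IsAbelianGalois ℚ (cyclo n) := by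
  have := isCyclotomicExtension_cyclo hn
  exact IsCyclotomicExtension.isAbelianGalois {n} ℚ _

theorem isGalois_of_le_of_isAbelianGalois {K L : Type*} [Field K] [Field L] [Algebra K L]
    {E E' : IntermediateField K L} (h : E ≤ E') (hE' : IsAbelianGalois K E') : IsGalois K E :=
  (IsAbelianGalois.of_algHom (IntermediateField.inclusion h)).toIsGalois

/-- Subfields of cyclotomic fields are Galois over `ℚ`, since cyclotomic fields are abelian. -/
theorem isGalois_of_le_cyclo {n : ℕ} (hn : n ≠ 0) {E : IntermediateField ℚ ℂ} (h : E ≤ cyclo n) :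
    FiniteDimensional ℚ E ∧ IsGalois ℚ E := by
  have := finiteDimensional_cyclo hn
  refine ⟨Module.Finite.of_injective (IntermediateField.inclusion h).toLinearMap
    (IntermediateField.inclusion h).injective, ?_⟩
  refine isGalois_of_le_of_isAbelianGalois h ?_
  convert isAbelianGalois_cyclo hn
  exact Subsingleton.elim _ _

theorem bFixed_le_cyclo (q k : ℕ) (r : ℤ) : bFixed q k r ≤ cyclo (q * k) :=
  IntermediateField.lift_le _

end FixedField

/-! ### Extension of homomorphisms -/

section Extension

/-- A homomorphism into an algebraically closed field extends along integral extensions. -/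
theorem exists_algHom_extension {K A B E : Type*} [Field K] [CommRing A] [CommRing B]
    [Algebra K A] [Algebra K B] [Algebra A B] [IsScalarTower K A B] [Algebra.IsIntegral A B]
    (hinj : Function.Injective (algebraMap A B)) [Field E] [IsAlgClosed E] [Algebra K E]
    (φ : A →ₐ[K] E) : ∃ χ : B →ₐ[K] E, ∀ x, χ (algebraMap A B x) = φ x := by
  obtain ⟨p, hp⟩ : ∃ p : Ideal A, p = RingHom.ker φ := ⟨_, rfl⟩
  have hprime : p.IsPrime := hp ▸ RingHom.ker_isPrime φ
  obtain ⟨Q, -, hQ, hQp⟩ := Ideal.exists_ideal_over_prime_of_isIntegral p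
    (⊥ : Ideal B) (by rw [← RingHom.ker_eq_comap_bot, (RingHom.injective_iff_ker_eq_bot _).mp hinj]
                      exact bot_le)
  have : Q.LiesOver p := ⟨hQp.symm⟩
  have hφp : ∀ x ∈ p, (φ : A →+* E) x = 0 := fun x hx => by rwa [hp] at hx
  let φ' : A ⧸ p →+* E := Ideal.Quotient.lift p (φ : A →+* E) hφp
  have hφ' : Function.Injective φ' :=
    RingHom.lift_injective_of_ker_le_ideal p hφp (by rw [hp]; exact le_rfl)
  let : Algebra (A ⧸ p) E := φ'.toAlgebra
  have : Module.IsTorsionFree (A ⧸ p) E := Module.isTorsionFree_iff_algebraMap_injective.mpr hφ'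
  have : FaithfulSMul (A ⧸ p) (B ⧸ Q) := Ideal.Quotient.instFaithfulSMul Q p
  have : Module.IsTorsionFree (A ⧸ p) (B ⧸ Q) := Module.isTorsionFree_iff_faithfulSMul.mpr this
  let χ : B ⧸ Q →ₐ[A ⧸ p] E := IsAlgClosed.lift
  have hχ : ∀ x : A, χ (Ideal.Quotient.mk Q (algebraMap A B x)) = φ x := fun x =>
    χ.commutes (Ideal.Quotient.mk _ x)
  refine ⟨{ (χ : B ⧸ Q →+* E).comp (Ideal.Quotient.mk Q) with
    commutes' := fun c => ?_ }, hχ⟩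
  have := hχ (algebraMap K A c)
  rwa [← IsScalarTower.algebraMap_apply, AlgHom.commutes] at this

open scoped IsMulCommutative in
/-- A homomorphism on the center of a finite-dimensional algebra extends to the subalgebra
generated by an element `u`, as far as it is defined there. -/
theorem exists_algHom_adjoin {K R E : Type*} [Field K] [Ring R] [Algebra K R]
    [FiniteDimensional K R] [Field E] [IsAlgClosed E] [Algebra K E] (u : R)
    (φ : Subalgebra.center K R →ₐ[K] E) :
    ∃ χ : Algebra.adjoin K {u} →ₐ[K] E, ∀ (x : Subalgebra.center K R)
      (hx : (x : R) ∈ Algebra.adjoin K {u}), χ ⟨x, hx⟩ = φ x := by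
  let P := Algebra.adjoin K {u}
  have : IsMulCommutative P := Algebra.isMulCommutative_adjoin K (by
    rintro _ rfl _ rfl; rfl)
  have : FiniteDimensional K P := FiniteDimensional.finiteDimensional_submodule
    (Subalgebra.toSubmodule P)
  let A : Subalgebra K P := (Subalgebra.center K R).comap P.val
  let φ' : A →ₐ[K] E := φ.comp ((P.val.comp A.val).codRestrict _ fun x => x.2)
  have : Algebra.IsIntegral A P := Algebra.IsIntegral.tower_top K
  obtain ⟨χ, hχ⟩ := exists_algHom_extension (K := K) (A := A) (B := P)
    Subtype.val_injective φ'
  exact ⟨χ, fun x hx => hχ ⟨⟨x, hx⟩, x.2⟩⟩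

end Extension

/-! ### Averages in the group algebra -/

section Average

variable {G : Type*} [Group G]

/-- The element `(1 / q) ∑ a ^ l`, over `l < q`, of the rational group algebra. For `a ^ q = 1` it
is the idempotent that projects onto the `a`-invariants. -/
noncomputable def avgElem (a : G) (q : ℕ) : MonoidAlgebra ℚ G :=
  (q : ℚ)⁻¹ • ∑ l ∈ Finset.range q, MonoidAlgebra.of ℚ G (a ^ l)

variable {a b : G} {q : ℕ}

theorem avgElem_one (hq : q ≠ 0) : avgElem (1 : G) q = 1 := by
  have hq' : (q : ℚ) ≠ 0 := Nat.cast_ne_zero.mpr hq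
  simp only [avgElem, one_pow, map_one, Finset.sum_const, Finset.card_range]
  rw [← Nat.cast_smul_eq_nsmul ℚ, inv_smul_smul₀ hq']

theorem exists_pow_eq_zpow (hq : q ≠ 0) (ha : a ^ q = 1) (i : ℤ) :
    ∃ N : ℕ, a ^ i = a ^ N ∧ (q : ℤ) ∣ N - i := by
  have hpos : (0 : ℤ) ≤ i % q := Int.emod_nonneg i (by exact_mod_cast hq)
  have hd : (q : ℤ) ∣ ((i % q).toNat : ℤ) - i := by
    rw [Int.toNat_of_nonneg hpos]
    exact Int.dvd_emod_sub_self
  refine ⟨(i % q).toNat, ?_, hd⟩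
  rw [← zpow_natCast]
  exact (zpow_eq_zpow_of_dvd ha hd).symm

theorem avgElem_mul_of_zpow (hq : q ≠ 0) (ha : a ^ q = 1) (i : ℤ) :
    avgElem a q * MonoidAlgebra.of ℚ G (a ^ i) = avgElem a q := by
  obtain ⟨N, hN, -⟩ := exists_pow_eq_zpow hq ha i
  rw [hN]
  clear hN
  induction N with
  | zero => rw [pow_zero, map_one, mul_one]
  | succ N ih =>
    rw [pow_succ, map_mul, ← mul_assoc, ih, avgElem, smul_mul_assoc, Finset.sum_mul,
      ← sum_range_shift (fun l => MonoidAlgebra.of ℚ G (a ^ l)) (by rw [ha, pow_zero])]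
    simp only [pow_succ, map_mul]

theorem of_zpow_mul_avgElem (hq : q ≠ 0) (ha : a ^ q = 1) (i : ℤ) :
    MonoidAlgebra.of ℚ G (a ^ i) * avgElem a q = avgElem a q := by
  conv_rhs => rw [← avgElem_mul_of_zpow hq ha i]
  rw [avgElem, mul_smul_comm, smul_mul_assoc, Finset.mul_sum, Finset.sum_mul]
  congr 1
  refine Finset.sum_congr rfl fun l _ => ?_
  rw [← map_mul, ← map_mul, ← zpow_natCast, ← zpow_add, ← zpow_add, add_comm]

theorem avgElem_zpow (hq : q ≠ 0) (ha : a ^ q = 1) {d : ℤ} (hd : IsCoprime d q) :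
    avgElem (a ^ d) q = avgElem a q := by
  have had : (a ^ d) ^ q = 1 := by
    rw [← zpow_natCast, zpow_comm, zpow_natCast, ha, one_zpow]
  obtain ⟨u, v, huv⟩ := hd
  have h1 : avgElem (a ^ d) q * avgElem a q = avgElem (a ^ d) q := by
    have : ∀ l : ℕ, avgElem (a ^ d) q * MonoidAlgebra.of ℚ G (a ^ l) = avgElem (a ^ d) q := by
      intro l
      have h : a ^ l = (a ^ d) ^ (u * l) := by
        rw [← zpow_mul, ← zpow_natCast]
        exact zpow_eq_zpow_of_dvd ha ⟨v * l, by linear_combination (-(l : ℤ)) * huv⟩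
      rw [h, avgElem_mul_of_zpow hq had]
    have hq' : (q : ℚ) ≠ 0 := Nat.cast_ne_zero.mpr hq
    conv_lhs => rw [avgElem.eq_1 a q, mul_smul_comm, Finset.mul_sum]
    simp only [this, Finset.sum_const, Finset.card_range]
    rw [← Nat.cast_smul_eq_nsmul ℚ, inv_smul_smul₀ hq']
  have h2 : avgElem (a ^ d) q * avgElem a q = avgElem a q := by
    have : ∀ l : ℕ, MonoidAlgebra.of ℚ G ((a ^ d) ^ l) * avgElem a q = avgElem a q := by
      intro l
      rw [← zpow_natCast, ← zpow_mul, of_zpow_mul_avgElem hq ha]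
    have hq' : (q : ℚ) ≠ 0 := Nat.cast_ne_zero.mpr hq
    conv_lhs => rw [avgElem.eq_1 (a ^ d) q, smul_mul_assoc, Finset.sum_mul]
    simp only [this, Finset.sum_const, Finset.card_range]
    rw [← Nat.cast_smul_eq_nsmul ℚ, inv_smul_smul₀ hq']
  rw [← h1, h2]

theorem avgElem_mul_self (hq : q ≠ 0) (ha : a ^ q = 1) :
    avgElem a q * avgElem a q = avgElem a q := by
  have hq' : (q : ℚ) ≠ 0 := Nat.cast_ne_zero.mpr hq
  have : ∀ l : ℕ, avgElem a q * MonoidAlgebra.of ℚ G (a ^ l) = avgElem a q := fun l => by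
    rw [← zpow_natCast, avgElem_mul_of_zpow hq ha]
  conv_lhs => enter [2]; rw [avgElem]
  rw [mul_smul_comm, Finset.mul_sum]
  simp only [this, Finset.sum_const, Finset.card_range]
  rw [← Nat.cast_smul_eq_nsmul ℚ, inv_smul_smul₀ hq']

/-- Averaging over the conjugates by `h ^ l`, for `l < N`. -/
noncomputable def avgConj (h : G) (N : ℕ) : MonoidAlgebra ℚ G →ₗ[ℚ] MonoidAlgebra ℚ G :=
  (N : ℚ)⁻¹ • ∑ l ∈ Finset.range N,
    LinearMap.mulLeft ℚ (MonoidAlgebra.of ℚ G (h ^ l)⁻¹) ∘ₗ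
      LinearMap.mulRight ℚ (MonoidAlgebra.of ℚ G (h ^ l))

theorem avgConj_apply (h : G) (N : ℕ) (x : MonoidAlgebra ℚ G) :
    avgConj h N x = (N : ℚ)⁻¹ • ∑ l ∈ Finset.range N,
      MonoidAlgebra.of ℚ G (h ^ l)⁻¹ * (x * MonoidAlgebra.of ℚ G (h ^ l)) := by
  rw [avgConj, LinearMap.smul_apply, LinearMap.sum_apply]
  rfl

theorem avgConj_mul_of_mem_center (h : G) (N : ℕ) (x : MonoidAlgebra ℚ G) {y : MonoidAlgebra ℚ G}
    (hy : y ∈ Subalgebra.center ℚ (MonoidAlgebra ℚ G)) :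
    avgConj h N (x * y) = avgConj h N x * y := by
  rw [avgConj_apply, avgConj_apply, smul_mul_assoc, Finset.sum_mul]
  congr 1
  refine Finset.sum_congr rfl fun l _ => ?_
  rw [mul_assoc x y, ← Subalgebra.mem_center_iff.mp hy, ← mul_assoc x, ← mul_assoc]

theorem avgConj_of_mem_center (h : G) {N : ℕ} (hN : N ≠ 0) {y : MonoidAlgebra ℚ G}
    (hy : y ∈ Subalgebra.center ℚ (MonoidAlgebra ℚ G)) : avgConj h N y = y := by
  have hN' : (N : ℚ) ≠ 0 := Nat.cast_ne_zero.mpr hN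
  have h1 : ∀ l : ℕ, MonoidAlgebra.of ℚ G (h ^ l)⁻¹ * (y * MonoidAlgebra.of ℚ G (h ^ l)) = y :=
    fun l => by
      rw [← Subalgebra.mem_center_iff.mp hy, ← mul_assoc, ← map_mul, inv_mul_cancel, map_one,
        one_mul]
  rw [avgConj_apply]
  simp only [h1, Finset.sum_const, Finset.card_range]
  rw [← Nat.cast_smul_eq_nsmul ℚ, inv_smul_smul₀ hN']

theorem mem_center_of_commute_generators (hg : ∀ g : G, ∃ (j : ℕ) (i : ℤ), g = b ^ j * a ^ i)
    {x : MonoidAlgebra ℚ G} (hxa : Commute (MonoidAlgebra.of ℚ G a) x)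
    (hxb : Commute (MonoidAlgebra.of ℚ G b) x) :
    x ∈ Subalgebra.center ℚ (MonoidAlgebra ℚ G) := by
  have hxa' : Commute (MonoidAlgebra.of ℚ G a⁻¹) x := by
    have h1 : MonoidAlgebra.of ℚ G a⁻¹ * MonoidAlgebra.of ℚ G a = 1 := by
      rw [← map_mul, inv_mul_cancel, map_one]
    have h2 : MonoidAlgebra.of ℚ G a * MonoidAlgebra.of ℚ G a⁻¹ = 1 := by
      rw [← map_mul, mul_inv_cancel, map_one]
    calc MonoidAlgebra.of ℚ G a⁻¹ * x
        = MonoidAlgebra.of ℚ G a⁻¹ * (x * MonoidAlgebra.of ℚ G a) *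
            MonoidAlgebra.of ℚ G a⁻¹ := by rw [mul_assoc, mul_assoc, h2, mul_one]
      _ = x * MonoidAlgebra.of ℚ G a⁻¹ := by rw [← hxa.eq, ← mul_assoc, h1, one_mul]
  have hz : ∀ i : ℤ, Commute (MonoidAlgebra.of ℚ G (a ^ i)) x := by
    rintro (i | i)
    · rw [Int.ofNat_eq_natCast, zpow_natCast, map_pow]; exact hxa.pow_left i
    · rw [zpow_negSucc, ← inv_pow, map_pow]; exact hxa'.pow_left _
  refine Subalgebra.mem_center_iff.mpr fun y => ?_
  induction y using MonoidAlgebra.induction_linear with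
  | zero => simp
  | add y z hy hz => rw [add_mul, mul_add, hy, hz]
  | single g c =>
    obtain ⟨j, i, rfl⟩ := hg g
    have : MonoidAlgebra.single (b ^ j * a ^ i) c =
        c • (MonoidAlgebra.of ℚ G b ^ j * MonoidAlgebra.of ℚ G (a ^ i)) := by
      rw [← map_pow, ← map_mul, MonoidAlgebra.of_apply, MonoidAlgebra.smul_single, smul_eq_mul,
        mul_one]
    rw [this]
    exact (((hxb.pow_left j).mul_left (hz i)).smul_left c).eq

end Average

/-! ### Homomorphisms from the center to `ℂ`: their images -/

section Central

variable {G : Type*} [Group G] {a b : G} {q n m k : ℕ} {r : ℤ}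

local notation "ρ" => MonoidAlgebra.of ℚ G

theorem avgElem_mem_center (hq : q ≠ 0) (ha : a ^ q = 1) (hab : b⁻¹ * a * b = a ^ r)
    (hr : IsCoprime r q) (hg : ∀ g : G, ∃ (j : ℕ) (i : ℤ), g = b ^ j * a ^ i) :
    avgElem a q ∈ Subalgebra.center ℚ (MonoidAlgebra ℚ G) := by
  refine mem_center_of_commute_generators hg ?_ ?_
  · have h1 := of_zpow_mul_avgElem hq ha 1
    have h2 := avgElem_mul_of_zpow hq ha 1
    rw [zpow_one] at h1 h2
    exact h1.trans h2.symm
  · have h : ∀ l : ℕ, a ^ l * b = b * (a ^ r) ^ l := fun l => by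
      have := zpow_mul_pow_eq hab l 1
      rw [pow_one, pow_one, zpow_natCast, mul_comm (l : ℤ), zpow_mul, zpow_natCast] at this
      exact this
    change _ = _
    conv_lhs => rw [← avgElem_zpow hq ha hr]
    rw [avgElem, avgElem, mul_smul_comm, smul_mul_assoc, Finset.mul_sum, Finset.sum_mul]
    congr 1
    exact Finset.sum_congr rfl fun l _ => by rw [← map_mul, ← map_mul, h]

/-- The sum of `b ^ j a ^ (i r ^ l)` over `l < m`. If `m ∣ j` it is, up to a positive factor, the
class sum of `b ^ j a ^ i`. -/
noncomputable def orbitSum (a b : G) (m : ℕ) (r : ℤ) (j : ℕ) (i : ℤ) : MonoidAlgebra ℚ G :=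
  ∑ l ∈ Finset.range m, ρ (b ^ j * a ^ (i * r ^ l))

theorem orbitSum_mem_center (ha : a ^ q = 1) (hab : b⁻¹ * a * b = a ^ r)
    (hr : orderOf (r : ZMod q) = m) (hg : ∀ g : G, ∃ (j : ℕ) (i : ℤ), g = b ^ j * a ^ i)
    {j : ℕ} (hj : m ∣ j) (i : ℤ) :
    orbitSum a b m r j i ∈ Subalgebra.center ℚ (MonoidAlgebra ℚ G) := by
  refine mem_center_of_commute_generators hg ?_ ?_
  · change _ = _
    rw [orbitSum, Finset.mul_sum, Finset.sum_mul]
    refine Finset.sum_congr rfl fun l _ => ?_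
    rw [← map_mul, ← map_mul]
    have h := zpow_mul_pow_eq hab 1 j
    rw [zpow_one, one_mul, zpow_eq_zpow_of_dvd ha ((dvd_pow_sub_one_iff hr j).mpr hj)] at h
    rw [← mul_assoc, h, mul_assoc, mul_assoc, ← zpow_add, ← zpow_add_one, add_comm]
  · change _ = _
    have hper : ρ (b * (b ^ j * a ^ (i * r ^ m))) = ρ (b * (b ^ j * a ^ (i * r ^ 0))) := by
      rw [zpow_eq_zpow_of_dvd ha (x := i * r ^ m) (y := i * r ^ 0)
        (by rw [← mul_sub, pow_zero]; exact (dvd_pow_orderOf_sub_one hr).mul_left i)]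
    rw [orbitSum, Finset.mul_sum, Finset.sum_mul]
    simp only [← map_mul]
    rw [← sum_range_shift (fun l => ρ (b * (b ^ j * a ^ (i * r ^ l)))) hper]
    refine Finset.sum_congr rfl fun l _ => ?_
    have h := zpow_mul_pow_eq hab (i * r ^ l) 1
    rw [pow_one, pow_one] at h
    rw [mul_assoc, h, ← mul_assoc, ← mul_assoc, ← pow_succ', ← pow_succ, mul_assoc i, ← pow_succ]

theorem of_pow_mem_center (ha : a ^ q = 1) (hab : b⁻¹ * a * b = a ^ r)
    (hr : orderOf (r : ZMod q) = m) (hg : ∀ g : G, ∃ (j : ℕ) (i : ℤ), g = b ^ j * a ^ i)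
    {j : ℕ} (hj : m ∣ j) : ρ (b ^ j) ∈ Subalgebra.center ℚ (MonoidAlgebra ℚ G) := by
  refine mem_center_of_commute_generators hg ?_ ?_
  · have h := zpow_mul_pow_eq hab 1 j
    rw [zpow_one, one_mul, zpow_eq_zpow_of_dvd ha ((dvd_pow_sub_one_iff hr j).mpr hj),
      zpow_one] at h
    change _ = _
    rw [← map_mul, ← map_mul, h]
  · change _ = _
    rw [← map_mul, ← map_mul, ← pow_succ, ← pow_succ']

/-- Averaging `b ^ j a ^ i` over the conjugates by powers of `a` fixes it if `a` commutes with
`b ^ j`; otherwise the result is the average over the whole coset of `⟨a⟩`. -/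
theorem avgConj_left_of (hab : b⁻¹ * a * b = a ^ r) (j : ℕ) (i : ℤ) :
    avgConj a q (ρ (b ^ j * a ^ i)) = ρ (b ^ j * a ^ i) * avgElem (a ^ (1 - r ^ j)) q := by
  rw [avgConj_apply, avgElem, mul_smul_comm, Finset.mul_sum]
  congr 1
  refine Finset.sum_congr rfl fun l _ => ?_
  rw [← map_mul, ← map_mul, ← map_mul]
  congr 1
  have h := zpow_mul_pow_eq hab (-l : ℤ) j
  rw [zpow_neg, zpow_natCast] at h
  rw [← mul_assoc, ← mul_assoc, h, mul_assoc, mul_assoc, mul_assoc, ← zpow_natCast a l,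
    ← zpow_natCast (a ^ (1 - r ^ j)) l, ← zpow_mul, ← zpow_add, ← zpow_add, ← zpow_add]
  congr 2
  ring

theorem avgConj_right_of (hab : b⁻¹ * a * b = a ^ r) (j : ℕ) (i : ℤ) :
    avgConj b m (ρ (b ^ j * a ^ i)) = (m : ℚ)⁻¹ • orbitSum a b m r j i := by
  rw [avgConj_apply, orbitSum]
  congr 1
  refine Finset.sum_congr rfl fun l _ => ?_
  rw [← map_mul, ← map_mul]
  congr 1
  rw [mul_assoc, zpow_mul_pow_eq hab, ← mul_assoc (b ^ j), ← pow_add, add_comm j, pow_add,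
    mul_assoc (b ^ l), inv_mul_cancel_left]

theorem of_mul_avgElem_mem_center (hq : q ≠ 0) (ha : a ^ q = 1) (hab : b⁻¹ * a * b = a ^ r)
    (hg : ∀ g : G, ∃ (j : ℕ) (i : ℤ), g = b ^ j * a ^ i)
    (he : avgElem a q ∈ Subalgebra.center ℚ (MonoidAlgebra ℚ G)) :
    ρ b * avgElem a q ∈ Subalgebra.center ℚ (MonoidAlgebra ℚ G) := by
  refine mem_center_of_commute_generators hg ?_ ?_
  · change _ = _
    have h := zpow_mul_pow_eq hab 1 1
    rw [pow_one, pow_one, zpow_one] at h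
    have h1 := avgElem_mul_of_zpow hq ha 1
    rw [zpow_one] at h1
    rw [mul_assoc (ρ b), h1, ← mul_assoc, ← map_mul, h, map_mul, mul_assoc,
      of_zpow_mul_avgElem hq ha]
  · change _ = _
    rw [mul_assoc (ρ b), ← Subalgebra.mem_center_iff.mp he]

variable (φ : Subalgebra.center ℚ (MonoidAlgebra ℚ G) →ₐ[ℚ] ℂ)

/-- If `φ` does not kill the averaging idempotent `e` of `⟨a⟩`, it factors through the group
algebra of `G / ⟨a⟩`, which is cyclic of order dividing `n`. -/
theorem adjoin_range_le_cyclo (hq : q ≠ 0) (hn : n ≠ 0) (ha : a ^ q = 1) (hb : b ^ n = 1)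
    (hab : b⁻¹ * a * b = a ^ r) (hg : ∀ g : G, ∃ (j : ℕ) (i : ℤ), g = b ^ j * a ^ i)
    (he : avgElem a q ∈ Subalgebra.center ℚ (MonoidAlgebra ℚ G)) (hφ : φ ⟨_, he⟩ = 1) :
    IntermediateField.adjoin ℚ (Set.range φ) ≤ cyclo n := by
  have hee := avgElem_mul_self hq ha
  have hbe := of_mul_avgElem_mem_center hq ha hab hg he
  let β : Subalgebra.center ℚ (MonoidAlgebra ℚ G) := ⟨_, hbe⟩
  let e : Subalgebra.center ℚ (MonoidAlgebra ℚ G) := ⟨_, he⟩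
  have hβ : ∀ j : ℕ, ((β ^ j * e : Subalgebra.center ℚ (MonoidAlgebra ℚ G)) :
      MonoidAlgebra ℚ G) = ρ (b ^ j) * avgElem a q := by
    intro j
    induction j with
    | zero => rw [pow_zero, one_mul, pow_zero, map_one, one_mul]
    | succ j ih =>
      have : (β ^ (j + 1) * e : Subalgebra.center ℚ (MonoidAlgebra ℚ G)) = β * (β ^ j * e) := by
        ring
      rw [this, Subalgebra.coe_mul, ih]
      change ρ b * avgElem a q * (ρ (b ^ j) * avgElem a q) = _
      rw [← mul_assoc, mul_assoc (ρ b), ← Subalgebra.mem_center_iff.mp he, ← mul_assoc (ρ b),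
        mul_assoc, hee, ← map_mul, ← pow_succ']
  have hφβ : φ β ^ n = 1 := by
    have : β ^ n * e = e := Subtype.ext (by rw [hβ, hb, map_one, one_mul])
    have h := congrArg φ this
    rwa [map_mul, map_pow, hφ, mul_one] at h
  have key : ∀ x : MonoidAlgebra ℚ G, ∃ y : Subalgebra.center ℚ (MonoidAlgebra ℚ G),
      x * avgElem a q = y * avgElem a q ∧ φ y ∈ cyclo n := by
    intro x
    induction x using MonoidAlgebra.induction_linear with
    | zero => exact ⟨0, by simp, by rw [map_zero]; exact zero_mem _⟩
    | add x x' hx hx' =>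
      obtain ⟨y, hy, hy'⟩ := hx
      obtain ⟨z, hz, hz'⟩ := hx'
      exact ⟨y + z, by rw [add_mul, hy, hz, Subalgebra.coe_add, add_mul],
        by rw [map_add]; exact add_mem hy' hz'⟩
    | single g c =>
      obtain ⟨j, i, rfl⟩ := hg g
      refine ⟨c • (β ^ j * e), ?_, ?_⟩
      · have : MonoidAlgebra.single (b ^ j * a ^ i) c = c • (ρ (b ^ j) * ρ (a ^ i)) := by
          rw [← map_mul, MonoidAlgebra.of_apply, MonoidAlgebra.smul_single, smul_eq_mul, mul_one]
        rw [this, Subalgebra.coe_smul, hβ, smul_mul_assoc, smul_mul_assoc, mul_assoc, mul_assoc,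
          of_zpow_mul_avgElem hq ha, hee]
      · rw [map_smul, map_mul, map_pow, hφ, mul_one]
        exact (cyclo n).smul_mem (pow_mem (mem_cyclo_of_pow_eq_one hn hφβ) j)
  rw [IntermediateField.adjoin_le_iff]
  rintro _ ⟨z, rfl⟩
  obtain ⟨y, hy, hy'⟩ := key z
  have h : z * e = y * e := Subtype.ext hy
  have h' := congrArg φ h
  rw [map_mul, map_mul, hφ, mul_one, mul_one] at h'
  rw [h']
  exact hy'

/-- The value of a homomorphism at an orbit sum is a trace of a root of unity. The powers of `a`
are not central, so the homomorphism is extended to the algebra generated by `a` first. -/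
theorem apply_orbitSum_mem_bFixed [Finite G] (hq : q.Prime) (hk : k ≠ 0) (hn : n = m * k)
    (ha : a ^ q = 1) (hb : b ^ n = 1) (hab : b⁻¹ * a * b = a ^ r)
    (hr : orderOf (r : ZMod q) = m) (hg : ∀ g : G, ∃ (j : ℕ) (i : ℤ), g = b ^ j * a ^ i)
    {j : ℕ} (hj : m ∣ j) (i : ℤ) :
    φ ⟨_, orbitSum_mem_center ha hab hr hg hj i⟩ ∈ bFixed q k r := by
  have hq0 := hq.ne_zero
  obtain ⟨χ, hχ⟩ := exists_algHom_adjoin (ρ a) φ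
  have haP : ρ a ∈ Algebra.adjoin ℚ {ρ a} := Algebra.subset_adjoin rfl
  -- the value of the extended homomorphism at `a` is a power of `ζ_q`
  have hω : χ ⟨ρ a, haP⟩ ^ q = 1 := by
    rw [← map_pow]
    have : (⟨ρ a, haP⟩ : Algebra.adjoin ℚ {ρ a}) ^ q = 1 := Subtype.ext (by
      rw [Subalgebra.coe_pow, Subalgebra.coe_one, ← map_pow, ha, map_one])
    rw [this, map_one]
  have : NeZero q := ⟨hq0⟩
  have : NeZero k := ⟨hk⟩
  obtain ⟨x, -, hx⟩ := (zeta_isPrimitiveRoot hq0).eq_pow_of_pow_eq_one hω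
  -- the value at the central element `b ^ j` is a power of `ζ_k`
  have hθ : φ ⟨_, of_pow_mem_center ha hab hr hg hj⟩ ^ k = 1 := by
    rw [← map_pow]
    have : (⟨_, of_pow_mem_center ha hab hr hg hj⟩ :
        Subalgebra.center ℚ (MonoidAlgebra ℚ G)) ^ k = 1 := Subtype.ext (by
      obtain ⟨d, rfl⟩ := hj
      rw [Subalgebra.coe_pow, Subalgebra.coe_one, ← map_pow, ← pow_mul,
        show m * d * k = n * d by rw [hn]; ring, pow_mul, hb, one_pow, map_one])
    rw [this, map_one]
  obtain ⟨y, -, hy⟩ := (zeta_isPrimitiveRoot hk).eq_pow_of_pow_eq_one hθ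
  have hη : φ ⟨_, orbitSum_mem_center ha hab hr hg (dvd_zero m) i⟩ =
      ∑ l ∈ Finset.range m, zeta q ^ (x * i * r ^ l) := by
    choose N hN hN' using fun l : ℕ => exists_pow_eq_zpow hq0 ha (i * r ^ l)
    have hsum : orbitSum a b m r 0 i = ((∑ l ∈ Finset.range m, ⟨ρ a, haP⟩ ^ N l :
        Algebra.adjoin ℚ {ρ a}) : MonoidAlgebra ℚ G) := by
      rw [AddSubmonoidClass.coe_finsetSum, orbitSum]
      refine Finset.sum_congr rfl fun l _ => ?_
      rw [Subalgebra.coe_pow, pow_zero, one_mul, hN, map_pow]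
    have hmem : orbitSum a b m r 0 i ∈ Algebra.adjoin ℚ {ρ a} := hsum ▸ Subtype.prop _
    rw [← hχ ⟨_, orbitSum_mem_center ha hab hr hg (dvd_zero m) i⟩ hmem]
    have : (⟨_, hmem⟩ : Algebra.adjoin ℚ {ρ a}) = ∑ l ∈ Finset.range m, ⟨ρ a, haP⟩ ^ N l :=
      Subtype.ext hsum
    rw [this, map_sum]
    refine Finset.sum_congr rfl fun l _ => ?_
    rw [map_pow, ← hx, ← pow_mul, ← zpow_natCast]
    refine zeta_zpow_congr hq0 ?_
    rw [Nat.cast_mul, mul_assoc, ← mul_sub]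
    exact (hN' l).mul_left x
  have hmul : (⟨_, orbitSum_mem_center ha hab hr hg hj i⟩ :
      Subalgebra.center ℚ (MonoidAlgebra ℚ G)) =
      ⟨_, of_pow_mem_center ha hab hr hg hj⟩ *
        ⟨_, orbitSum_mem_center ha hab hr hg (dvd_zero m) i⟩ := Subtype.ext (by
    rw [Subalgebra.coe_mul]
    simp only [orbitSum, Finset.mul_sum, ← map_mul, pow_zero, one_mul])
  have := zetaTrace_mem_bFixed hq0 hk hr (x * i) y
  rw [hmul, map_mul, hη, ← hy, Finset.mul_sum]
  simpa only [zetaTrace, zpow_natCast] using this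

/-- If `φ` kills the averaging idempotent `e` of `⟨a⟩`, its values are traces of roots of unity:
averaging over conjugates shows that modulo `e` the center is spanned by orbit sums. -/
theorem adjoin_range_le_bFixed [Finite G] (hq : q.Prime) (hm : m ≠ 0) (hk : k ≠ 0) (hn : n = m * k)
    (ha : a ^ q = 1) (hb : b ^ n = 1) (hab : b⁻¹ * a * b = a ^ r)
    (hr : orderOf (r : ZMod q) = m) (hg : ∀ g : G, ∃ (j : ℕ) (i : ℤ), g = b ^ j * a ^ i)
    (he : avgElem a q ∈ Subalgebra.center ℚ (MonoidAlgebra ℚ G)) (hφ : φ ⟨_, he⟩ = 0) :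
    IntermediateField.adjoin ℚ (Set.range φ) ≤ bFixed q k r := by
  have hq0 := hq.ne_zero
  let f : Subalgebra.center ℚ (MonoidAlgebra ℚ G) := 1 - ⟨_, he⟩
  have hef : avgElem a q * (f : MonoidAlgebra ℚ G) = 0 := by
    change avgElem a q * (1 - avgElem a q) = 0
    rw [mul_sub, mul_one, avgElem_mul_self hq0 ha, sub_self]
  have hφf : φ f = 1 := by rw [map_sub, hφ, map_one, sub_zero]
  have key : ∀ x : MonoidAlgebra ℚ G, ∃ y : Subalgebra.center ℚ (MonoidAlgebra ℚ G),
      avgConj b m (avgConj a q x * f) = y * f ∧ φ y ∈ bFixed q k r := by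
    intro x
    induction x using MonoidAlgebra.induction_linear with
    | zero => exact ⟨0, by simp, by rw [map_zero]; exact zero_mem _⟩
    | add x x' hx hx' =>
      obtain ⟨y, hy, hy'⟩ := hx
      obtain ⟨z, hz, hz'⟩ := hx'
      exact ⟨y + z, by rw [map_add, add_mul, map_add, hy, hz, Subalgebra.coe_add, add_mul],
        by rw [map_add]; exact add_mem hy' hz'⟩
    | single g c =>
      obtain ⟨j, i, rfl⟩ := hg g
      have hs : MonoidAlgebra.single (b ^ j * a ^ i) c = c • ρ (b ^ j * a ^ i) := by
        rw [MonoidAlgebra.of_apply, MonoidAlgebra.smul_single, smul_eq_mul, mul_one]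
      by_cases hj : m ∣ j
      · refine ⟨c • (m : ℚ)⁻¹ • ⟨_, orbitSum_mem_center ha hab hr hg hj i⟩, ?_, ?_⟩
        · have h1 : a ^ (1 - r ^ j) = 1 := by
            rw [zpow_eq_zpow_of_dvd ha (y := 0), zpow_zero]
            have := (dvd_pow_sub_one_iff hr j).mpr hj
            rwa [sub_zero, dvd_sub_comm]
          rw [hs, map_smul, avgConj_left_of hab, h1, avgElem_one hq0, mul_one,
            avgConj_mul_of_mem_center _ _ _ f.2, map_smul, avgConj_right_of hab]
          rfl
        · rw [map_smul, map_smul]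
          exact (bFixed q k r).smul_mem ((bFixed q k r).smul_mem
            (apply_orbitSum_mem_bFixed φ hq hk hn ha hb hab hr hg hj i))
      · refine ⟨0, ?_, by rw [map_zero]; exact zero_mem _⟩
        have h1 : avgElem (a ^ (1 - r ^ j)) q = avgElem a q := by
          refine avgElem_zpow hq0 ha ?_
          have : ¬ (q : ℤ) ∣ 1 - r ^ j := by
            rwa [dvd_sub_comm, dvd_pow_sub_one_iff hr]
          exact ((Nat.prime_iff_prime_int.mp hq).coprime_iff_not_dvd.mpr this).symm
        rw [hs, map_smul, avgConj_left_of hab, h1, smul_mul_assoc, mul_assoc, hef]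
        simp
  rw [IntermediateField.adjoin_le_iff]
  rintro _ ⟨z, rfl⟩
  obtain ⟨y, hy, hy'⟩ := key z
  rw [avgConj_of_mem_center a hq0 z.2, avgConj_of_mem_center b hm (mul_mem z.2 f.2)] at hy
  have h : z * f = y * f := Subtype.ext hy
  have h' := congrArg φ h
  rw [map_mul, map_mul, hφf, mul_one, mul_one] at h'
  rw [h']
  exact hy'

theorem adjoin_range_le [Finite G] (hq : q.Prime) (hm : m ≠ 0) (hk : k ≠ 0) (hn : n = m * k)
    (ha : a ^ q = 1) (hb : b ^ n = 1) (hab : b⁻¹ * a * b = a ^ r)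
    (hr : orderOf (r : ZMod q) = m) (hg : ∀ g : G, ∃ (j : ℕ) (i : ℤ), g = b ^ j * a ^ i) :
    IntermediateField.adjoin ℚ (Set.range φ) ≤ cyclo n ∨
      IntermediateField.adjoin ℚ (Set.range φ) ≤ bFixed q k r := by
  have he := avgElem_mem_center hq.ne_zero ha hab (isCoprime_of_orderOf hm hr) hg
  have hidem : IsIdempotentElem (φ ⟨_, he⟩) := by
    have : IsIdempotentElem (⟨_, he⟩ : Subalgebra.center ℚ (MonoidAlgebra ℚ G)) :=
      Subtype.ext (avgElem_mul_self hq.ne_zero ha)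
    exact this.map φ
  rcases IsIdempotentElem.iff_eq_zero_or_one.mp hidem with h | h
  · exact Or.inr (adjoin_range_le_bFixed φ hq hm hk hn ha hb hab hr hg he h)
  · refine Or.inl (adjoin_range_le_cyclo φ hq.ne_zero ?_ ha hb hab hg he h)
    rw [hn]; exact mul_ne_zero hm hk

end Central

/-! ### Homomorphisms from the center to `ℂ`: existence -/

section Existence

variable {G : Type*} [Group G] {a b : G} {q n m k : ℕ} {r : ℤ}

local notation "ρ" => MonoidAlgebra.of ℚ G

/-- The linear character with `a ↦ 1` and `b ↦ ζ_n` induces a homomorphism from the center of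
`ℚG` that takes the value `ζ_n`. -/
theorem exists_algHom_zeta_mem_range (hq : q ≠ 0) (hn : n ≠ 0) (ha : a ^ q = 1)
    (hab : b⁻¹ * a * b = a ^ r) (hg : ∀ g : G, ∃ (j : ℕ) (i : ℤ), g = b ^ j * a ^ i)
    (he : avgElem a q ∈ Subalgebra.center ℚ (MonoidAlgebra ℚ G))
    (hlift : ∀ (H : Type) [Group H] (α β : H), α ^ q = 1 → β ^ n = 1 → β⁻¹ * α * β = α ^ r →
        ∃ f : G →* H, f a = α ∧ f b = β) :
    ∃ φ : Subalgebra.center ℚ (MonoidAlgebra ℚ G) →ₐ[ℚ] ℂ, zeta n ∈ Set.range φ := by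
  obtain ⟨f, hfa, hfb⟩ := hlift ℂˣ 1 (Units.mk0 (zeta n) (zeta_ne_zero n)) (one_pow q)
    (Units.ext (by simpa using zeta_pow_self hn)) (by simp)
  let Φ : MonoidAlgebra ℚ G →ₐ[ℚ] ℂ := MonoidAlgebra.lift ℚ ℂ G ((Units.coeHom ℂ).comp f)
  have hΦ : ∀ g, Φ (ρ g) = f g := fun g => MonoidAlgebra.lift_of _ _
  have hΦe : Φ (avgElem a q) = 1 := by
    have hq' : (q : ℚ) ≠ 0 := Nat.cast_ne_zero.mpr hq
    rw [avgElem, map_smul, map_sum]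
    simp only [hΦ, map_pow, hfa, one_pow, Units.val_one, Finset.sum_const, Finset.card_range]
    rw [← Nat.cast_smul_eq_nsmul ℚ, inv_smul_smul₀ hq']
  refine ⟨Φ.comp (Subalgebra.val _), ⟨_, of_mul_avgElem_mem_center hq ha hab hg he⟩, ?_⟩
  change Φ (ρ b * avgElem a q) = zeta n
  rw [map_mul, hΦe, hΦ, hfb, mul_one, Units.val_mk0]

section Induced

variable (q n r)

/-- The weights `ζ_q ^ (r ^ i)` through which `a` acts on the representation induced from
`⟨a⟩`. -/
noncomputable def weight (i : ZMod n) : ℂ := zeta q ^ (r ^ i.val)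

theorem weight_ne_zero (i : ZMod n) : weight q n r i ≠ 0 := zpow_ne_zero _ (zeta_ne_zero q)

/-- The action of `a` on the functions `ZMod n → ℂ`: multiplication by the weights. -/
noncomputable def diagUnit : (Module.End ℂ (ZMod n → ℂ))ˣ where
  val := LinearMap.mulLeft ℂ (weight q n r)
  inv := LinearMap.mulLeft ℂ (weight q n r)⁻¹
  val_inv := LinearMap.ext fun f => funext fun i =>
    mul_inv_cancel_left₀ (weight_ne_zero q n r i) (f i)
  inv_val := LinearMap.ext fun f => funext fun i =>
    inv_mul_cancel_left₀ (weight_ne_zero q n r i) (f i)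

/-- The action of `b` on the functions `ZMod n → ℂ`: translation. -/
noncomputable def shiftUnit : (Module.End ℂ (ZMod n → ℂ))ˣ where
  val := LinearMap.funLeft ℂ ℂ fun i => i - 1
  inv := LinearMap.funLeft ℂ ℂ fun i => i + 1
  val_inv := LinearMap.ext fun f => funext fun i => by
    simp [LinearMap.funLeft_apply]
  inv_val := LinearMap.ext fun f => funext fun i => by
    simp [LinearMap.funLeft_apply]

variable {q n r}

theorem diagUnit_apply (f : ZMod n → ℂ) (i : ZMod n) :
    (diagUnit q n r : Module.End ℂ (ZMod n → ℂ)) f i = weight q n r i * f i := rfl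

theorem shiftUnit_apply (f : ZMod n → ℂ) (i : ZMod n) :
    (shiftUnit n : Module.End ℂ (ZMod n → ℂ)) f i = f (i - 1) := rfl

theorem shiftUnit_inv_apply (f : ZMod n → ℂ) (i : ZMod n) :
    ((shiftUnit n)⁻¹ : (Module.End ℂ (ZMod n → ℂ))ˣ).val f i = f (i + 1) := rfl

theorem diagUnit_pow_apply (f : ZMod n → ℂ) (i : ZMod n) (j : ℕ) :
    ((diagUnit q n r ^ j : (Module.End ℂ (ZMod n → ℂ))ˣ) : Module.End ℂ (ZMod n → ℂ)) f i =
      weight q n r i ^ j * f i := by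
  induction j with
  | zero => simp
  | succ j ih =>
    rw [pow_succ', Units.val_mul, Module.End.mul_apply, diagUnit_apply, ih]
    ring

theorem shiftUnit_pow_apply (f : ZMod n → ℂ) (i : ZMod n) (j : ℕ) :
    ((shiftUnit n ^ j : (Module.End ℂ (ZMod n → ℂ))ˣ) : Module.End ℂ (ZMod n → ℂ)) f i =
      f (i - j) := by
  induction j generalizing i with
  | zero => simp
  | succ j ih =>
    rw [pow_succ', Units.val_mul, Module.End.mul_apply, shiftUnit_apply, ih]
    congr 1
    push_cast; ring

theorem diagUnit_pow_self (hq : q ≠ 0) : diagUnit q n r ^ q = 1 := by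
  refine Units.ext (LinearMap.ext fun f => funext fun i => ?_)
  have : weight q n r i ^ q = 1 := by
    rw [weight, ← zpow_natCast, zpow_comm, zpow_natCast, zeta_pow_self hq, one_zpow]
  rw [diagUnit_pow_apply, this, one_mul, Units.val_one, Module.End.one_apply]

theorem shiftUnit_pow_self : shiftUnit n ^ n = 1 := by
  refine Units.ext (LinearMap.ext fun f => funext fun i => ?_)
  rw [shiftUnit_pow_apply, ZMod.natCast_self, sub_zero, Units.val_one, Module.End.one_apply]

theorem weight_natCast (hq : q ≠ 0) (hr : orderOf (r : ZMod q) = m) (hm : m ∣ n) (j : ℕ) :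
    weight q n r j = zeta q ^ (r ^ j) := by
  refine zeta_zpow_congr hq ?_
  rw [ZMod.val_natCast]
  conv_rhs => enter [2]; rw [← Nat.mod_add_div j n, pow_add]
  have h := (dvd_pow_sub_one_iff hr (n * (j / n))).mpr (hm.mul_right _)
  have := (h.mul_left (r ^ (j % n))).neg_right
  rwa [show -(r ^ (j % n) * (r ^ (n * (j / n)) - 1)) =
    r ^ (j % n) - r ^ (j % n) * r ^ (n * (j / n)) by ring] at this

theorem diagUnit_conj [NeZero n] (hq : q ≠ 0) (hr : orderOf (r : ZMod q) = m) (hm : m ∣ n) :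
    (shiftUnit n)⁻¹ * diagUnit q n r * shiftUnit n = diagUnit q n r ^ r := by
  obtain ⟨N, hN, hN'⟩ := exists_pow_eq_zpow hq (diagUnit_pow_self (n := n) (r := r) hq) r
  rw [hN]
  refine Units.ext (LinearMap.ext fun f => funext fun i => ?_)
  obtain ⟨j, rfl⟩ : ∃ j : ℕ, (j : ZMod n) = i := ⟨i.val, ZMod.natCast_zmod_val i⟩
  rw [diagUnit_pow_apply, Units.val_mul, Units.val_mul, Module.End.mul_apply,
    Module.End.mul_apply, shiftUnit_inv_apply, diagUnit_apply, shiftUnit_apply,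
    add_sub_cancel_right]
  congr 1
  rw [← Nat.cast_succ, weight_natCast hq hr hm, weight_natCast hq hr hm, ← zpow_natCast,
    ← zpow_mul]
  refine zeta_zpow_congr hq ?_
  rw [pow_succ, ← mul_sub]
  exact (dvd_sub_comm.mp hN').mul_left _

variable (n m k) in
/-- The joint eigenvector of `a` and `b ^ m`, with eigenvalues `ζ_q` and `ζ_k`, in the induced
representation. It is supported on the multiples of `m`. -/
noncomputable def eigenvector (i : ZMod n) : ℂ :=
  ∑ d ∈ Finset.range k, (zeta k ^ d)⁻¹ * if i = ((m * d : ℕ) : ZMod n) then 1 else 0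

theorem eigenvector_zero (hm : m ≠ 0) (hk : k ≠ 0) (hn : n = m * k) :
    eigenvector n m k 0 = 1 := by
  rw [eigenvector, Finset.sum_eq_single 0]
  · simp
  · intro d hd hd0
    rw [if_neg, mul_zero]
    rw [eq_comm, ZMod.natCast_eq_zero_iff, hn, mul_dvd_mul_iff_left hm]
    intro h
    exact absurd (Nat.le_of_dvd (Nat.pos_of_ne_zero hd0) h) (not_le.mpr (Finset.mem_range.mp hd))
  · intro h
    exact absurd (Finset.mem_range.mpr (Nat.pos_of_ne_zero hk)) h

theorem diagUnit_eigenvector (hq : q ≠ 0) (hr : orderOf (r : ZMod q) = m) (hm : m ∣ n) :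
    (diagUnit q n r : Module.End ℂ (ZMod n → ℂ)) (eigenvector n m k) =
      zeta q • eigenvector n m k := by
  funext i
  rw [diagUnit_apply, Pi.smul_apply, smul_eq_mul, eigenvector, Finset.mul_sum, Finset.mul_sum]
  refine Finset.sum_congr rfl fun d _ => ?_
  by_cases h : i = ((m * d : ℕ) : ZMod n)
  · rw [h, weight_natCast hq hr hm]
    congr 1
    conv_rhs => rw [← zpow_one (zeta q)]
    exact zeta_zpow_congr hq ((dvd_pow_sub_one_iff hr _).mpr (dvd_mul_right m d))
  · rw [if_neg h, mul_zero, mul_zero, mul_zero]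

theorem shiftUnit_pow_eigenvector (hk : k ≠ 0) (hn : n = m * k) :
    ((shiftUnit n ^ m : (Module.End ℂ (ZMod n → ℂ))ˣ) : Module.End ℂ (ZMod n → ℂ))
      (eigenvector n m k) = zeta k • eigenvector n m k := by
  funext i
  have hper : ((zeta k ^ k)⁻¹ * if i = ((m * k : ℕ) : ZMod n) then (1 : ℂ) else 0) =
      (zeta k ^ 0)⁻¹ * if i = ((m * 0 : ℕ) : ZMod n) then 1 else 0 := by
    rw [zeta_pow_self hk, pow_zero, ← hn, mul_zero, ZMod.natCast_self, Nat.cast_zero]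
  rw [shiftUnit_pow_apply, Pi.smul_apply, smul_eq_mul, eigenvector, eigenvector,
    ← sum_range_shift
      (fun d => (zeta k ^ d)⁻¹ * if i = ((m * d : ℕ) : ZMod n) then (1 : ℂ) else 0) hper,
    Finset.mul_sum]
  refine Finset.sum_congr rfl fun d _ => ?_
  rw [pow_succ', mul_inv, mul_assoc, mul_inv_cancel_left₀ (zeta_ne_zero k)]
  congr 2
  rw [mul_add, mul_one, Nat.cast_add, sub_eq_iff_eq_add]

/-- The joint eigenspace of `a` and `b ^ m` that contains the eigenvector is one-dimensional. -/
theorem eq_smul_eigenvector [NeZero n] (hq : q ≠ 0) (hk : k ≠ 0) (hm : m ≠ 0) (hn : n = m * k)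
    (hr : orderOf (r : ZMod q) = m) {g : ZMod n → ℂ}
    (hg : (diagUnit q n r : Module.End ℂ (ZMod n → ℂ)) g = zeta q • g)
    (hg' : ((shiftUnit n ^ m : (Module.End ℂ (ZMod n → ℂ))ˣ) : Module.End ℂ (ZMod n → ℂ)) g =
      zeta k • g) : g = g 0 • eigenvector n m k := by
  have hmn : m ∣ n := ⟨k, hn⟩
  -- it suffices to show that an element of the eigenspace vanishing at `0` is zero
  let h : ZMod n → ℂ := g - g 0 • eigenvector n m k
  have h0 : h 0 = 0 := by
    simp only [h, Pi.sub_apply, Pi.smul_apply, eigenvector_zero hm hk hn, smul_eq_mul, mul_one,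
      sub_self]
  have hh : (diagUnit q n r : Module.End ℂ (ZMod n → ℂ)) h = zeta q • h := by
    simp only [h]
    rw [map_sub, map_smul, hg, diagUnit_eigenvector hq hr hmn, smul_sub, smul_comm]
  have hh' : ((shiftUnit n ^ m : (Module.End ℂ (ZMod n → ℂ))ˣ) : Module.End ℂ (ZMod n → ℂ)) h =
      zeta k • h := by
    simp only [h]
    rw [map_sub, map_smul, hg', shiftUnit_pow_eigenvector hk hn, smul_sub, smul_comm]
  have hd : ∀ d : ℕ, h ((m * d : ℕ) : ZMod n) = 0 := by
    intro d
    induction d with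
    | zero => rw [mul_zero, Nat.cast_zero, h0]
    | succ d ih =>
      have := congrFun hh' ((m * (d + 1) : ℕ) : ZMod n)
      rw [shiftUnit_pow_apply, mul_add, mul_one, Nat.cast_add, add_sub_cancel_right, ih,
        Pi.smul_apply, smul_eq_mul, eq_comm, mul_eq_zero] at this
      rw [mul_add, mul_one, Nat.cast_add]
      exact this.resolve_left (zeta_ne_zero k)
  have hzero : h = 0 := by
    funext i
    obtain ⟨j, rfl⟩ : ∃ j : ℕ, (j : ZMod n) = i := ⟨i.val, ZMod.natCast_zmod_val i⟩
    by_cases hj : m ∣ j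
    · obtain ⟨d, rfl⟩ := hj
      exact hd d
    · have h1 := congrFun hh (j : ZMod n)
      rw [diagUnit_apply, Pi.smul_apply, smul_eq_mul, weight_natCast hq hr hmn] at h1
      by_contra h2
      have h3 := mul_right_cancel₀ h2 h1
      have h4 : zeta q ^ (r ^ j - 1) = 1 := by
        rw [zpow_sub₀ (zeta_ne_zero q), h3, zpow_one, div_self (zeta_ne_zero q)]
      exact hj ((dvd_pow_sub_one_iff hr j).mp
        (((zeta_isPrimitiveRoot hq).zpow_eq_one_iff_dvd _).mp h4))
  exact sub_eq_zero.mp hzero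

end Induced

/-- An algebra acting on a module so that a nonzero vector is an eigenvector of each of its
elements has a homomorphism to the scalars, given by the eigenvalues. -/
theorem exists_algHom_of_forall_eigenvector {K S E V : Type*} [Field K] [Ring S] [Algebra K S]
    [Field E] [Algebra K E] [AddCommGroup V] [Module E V] [Module K V] [IsScalarTower K E V]
    (Φ : S →ₐ[K] Module.End E V) {v : V} (hv : v ≠ 0) (h : ∀ s, ∃ c : E, Φ s v = c • v) :
    ∃ φ : S →ₐ[K] E, ∀ s, Φ s v = φ s • v := by
  choose c hc using h
  have huniq : ∀ s d, Φ s v = d • v → c s = d := fun s d hd =>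
    smul_left_injective E hv ((hc s).symm.trans hd)
  refine ⟨AlgHom.ofLinearMap { toFun := c, map_add' := ?_, map_smul' := ?_ } ?_ ?_, hc⟩
  · intro s s'
    exact huniq _ _ (by rw [map_add, LinearMap.add_apply, hc, hc, add_smul])
  · intro x s
    exact huniq _ _ (by rw [map_smul, LinearMap.smul_apply, hc, RingHom.id_apply, smul_assoc])
  · exact huniq _ _ (by rw [map_one, Module.End.one_apply, one_smul])
  · intro s s'
    exact huniq _ _ (by
      rw [map_mul, Module.End.mul_apply, hc, map_smul, hc, smul_smul]
      exact congrArg (· • v) (mul_comm (c s') (c s)))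

/-- The central character of the representation induced from a character of `⟨a, b ^ m⟩` with
`a ↦ ζ_q` and `b ^ m ↦ ζ_k` takes all traces of roots of unity as values. -/
theorem exists_algHom_bFixed_le [Finite G] (hq : q.Prime) (hqk : q.Coprime k) (hk : k ≠ 0)
    (hm : m ≠ 0) (hn : n = m * k) (ha : a ^ q = 1) (hab : b⁻¹ * a * b = a ^ r)
    (hr : orderOf (r : ZMod q) = m) (hg : ∀ g : G, ∃ (j : ℕ) (i : ℤ), g = b ^ j * a ^ i)
    (hlift : ∀ (H : Type) [Group H] (α β : H), α ^ q = 1 → β ^ n = 1 → β⁻¹ * α * β = α ^ r →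
        ∃ f : G →* H, f a = α ∧ f b = β) :
    ∃ φ : Subalgebra.center ℚ (MonoidAlgebra ℚ G) →ₐ[ℚ] ℂ,
      bFixed q k r ≤ IntermediateField.adjoin ℚ (Set.range φ) := by
  have hq0 := hq.ne_zero
  have hmn : m ∣ n := ⟨k, hn⟩
  have : NeZero n := ⟨by rw [hn]; exact mul_ne_zero hm hk⟩
  obtain ⟨f, hfa, hfb⟩ := hlift (Module.End ℂ (ZMod n → ℂ))ˣ (diagUnit q n r) (shiftUnit n)
    (diagUnit_pow_self hq0) shiftUnit_pow_self (diagUnit_conj hq0 hr hmn)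
  let Φ : MonoidAlgebra ℚ G →ₐ[ℚ] Module.End ℂ (ZMod n → ℂ) :=
    MonoidAlgebra.lift ℚ _ G ((Units.coeHom _).comp f)
  have hΦ : ∀ g, Φ (ρ g) = f g := fun g => MonoidAlgebra.lift_of _ _
  let v := eigenvector n m k
  have hv0 : v ≠ 0 := fun h => by
    have h1 : eigenvector n m k 0 = 0 := congrFun h 0
    rw [eigenvector_zero hm hk hn] at h1
    exact one_ne_zero h1
  have hav : Φ (ρ a) v = zeta q • v := by
    rw [hΦ, hfa]; exact diagUnit_eigenvector hq0 hr hmn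
  have hbv : Φ (ρ (b ^ m)) v = zeta k • v := by
    rw [hΦ, map_pow, hfb]; exact shiftUnit_pow_eigenvector hk hn
  obtain ⟨φ, hφ⟩ := exists_algHom_of_forall_eigenvector (Φ.comp (Subalgebra.center ℚ _).val) hv0
    (fun z => by
      refine ⟨Φ z v 0, eq_smul_eigenvector hq0 hk hm hn hr ?_ ?_⟩
      · rw [← hfa, ← hΦ, AlgHom.comp_apply, ← Module.End.mul_apply, ← map_mul]
        change Φ (ρ a * (z : MonoidAlgebra ℚ G)) v = _
        rw [Subalgebra.mem_center_iff.mp z.2, map_mul, Module.End.mul_apply, hav, map_smul]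
        rfl
      · rw [← hfb, ← map_pow, ← hΦ, AlgHom.comp_apply, ← Module.End.mul_apply, ← map_mul]
        change Φ (ρ (b ^ m) * (z : MonoidAlgebra ℚ G)) v = _
        rw [Subalgebra.mem_center_iff.mp z.2, map_mul, Module.End.mul_apply, hbv, map_smul]
        rfl)
  refine ⟨φ, bFixed_le_of_zetaTrace_mem hq0 hk hm hqk hr _ fun x y => ?_⟩
  have hpow : ∀ (g : G) (c : ℂ), Φ (ρ g) v = c • v → ∀ N : ℕ, Φ (ρ (g ^ N)) v = c ^ N • v := by
    intro g c h N
    induction N with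
    | zero => rw [pow_zero, pow_zero, map_one, map_one, Module.End.one_apply, one_smul]
    | succ N ih =>
      rw [pow_succ, map_mul, map_mul, Module.End.mul_apply, h, map_smul, ih, smul_smul, pow_succ']
  have hapow : ∀ i : ℤ, Φ (ρ (a ^ i)) v = zeta q ^ i • v := fun i => by
    obtain ⟨N, hN, hN'⟩ := exists_pow_eq_zpow hq0 ha i
    rw [hN, hpow a _ hav, ← zpow_natCast, zeta_zpow_congr hq0 hN']
  -- a natural exponent representing `y` modulo `k`
  obtain ⟨y', hy'⟩ : ∃ y' : ℕ, zeta k ^ y = zeta k ^ y' := by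
    refine ⟨(y % k).toNat, ?_⟩
    rw [← zpow_natCast]
    refine zeta_zpow_congr hk ?_
    rw [Int.toNat_of_nonneg (Int.emod_nonneg y (by exact_mod_cast hk)), dvd_sub_comm]
    exact Int.dvd_emod_sub_self
  refine IntermediateField.subset_adjoin _ _
    ⟨⟨_, orbitSum_mem_center ha hab hr hg (dvd_mul_right m y') x⟩, ?_⟩
  refine smul_left_injective ℂ hv0 ?_
  change φ _ • v = zetaTrace q k m r x y • v
  rw [← hφ]
  change Φ (orbitSum a b m r (m * y') x) v = _
  rw [orbitSum, map_sum, LinearMap.sum_apply, zetaTrace, Finset.sum_smul]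
  refine Finset.sum_congr rfl fun l _ => ?_
  rw [map_mul, map_mul, Module.End.mul_apply, hapow, map_smul, pow_mul, hpow _ _ hbv, smul_smul,
    hy', mul_comm]

end Existence

/-! ### The condition on `ℚ(ζ_n)` -/

section GaloisImage

theorem galImage_eq_range {n : ℕ} [NeZero n] (K : IntermediateField ℚ ℂ)
    (hζ : IsPrimitiveRoot (IntermediateField.AdjoinSimple.gen K (zeta n)) n) :
    galImage n K = Set.range (hζ.autToPow K) := by
  ext u
  constructor
  · rintro ⟨σ, hσ⟩
    refine ⟨σ, Units.ext (ZMod.val_injective n ?_)⟩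
    refine hζ.pow_inj (ZMod.val_lt _) (ZMod.val_lt _) ?_
    rw [hζ.autToPow_spec K σ, hσ]
  · rintro ⟨σ, rfl⟩
    exact ⟨σ, (hζ.autToPow_spec K σ).symm⟩

theorem ncard_galImage {n : ℕ} (hn : n ≠ 0) (K : IntermediateField ℚ ℂ) :
    (galImage n K).ncard = Module.finrank K (IntermediateField.adjoin K {zeta n}) := by
  have : NeZero n := ⟨hn⟩
  have hz := zeta_isPrimitiveRoot hn
  have hζ : IsPrimitiveRoot (IntermediateField.AdjoinSimple.gen K (zeta n)) n :=
    IsPrimitiveRoot.of_map_of_injective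
      (f := (IntermediateField.adjoin K {zeta n}).val) hz
      (IntermediateField.adjoin K {zeta n}).val.injective
  have : IsCyclotomicExtension {n} K (IntermediateField.adjoin K {zeta n}) :=
    (IntermediateField.isCyclotomicExtension_singleton_iff_eq_adjoin _ _ _ _ hz).mpr rfl
  have : FiniteDimensional K (IntermediateField.adjoin K {zeta n}) :=
    IsCyclotomicExtension.finiteDimensional {n} K _
  have : IsGalois K (IntermediateField.adjoin K {zeta n}) :=
    IsCyclotomicExtension.isGalois {n} K _
  rw [galImage_eq_range K hζ, ← Set.image_univ,
    Set.ncard_image_of_injective _ (hζ.autToPow_injective K), Set.ncard_univ,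
    IsGalois.card_aut_eq_finrank]

/-- Both conditions say that `ℚ(ζ_n)` and `K` are linearly disjoint. -/
theorem inf_cyclo_eq_bot_iff {n : ℕ} (hn : n ≠ 0) (K : IntermediateField ℚ ℂ)
    [FiniteDimensional ℚ K] :
    cyclo n ⊓ K = ⊥ ↔ (galImage n K).ncard = n.totient := by
  have : NeZero n := ⟨hn⟩
  obtain ⟨_, hgal⟩ := isGalois_of_le_cyclo hn (le_refl (cyclo n))
  -- the two structures of `ℚ`-algebra on the field `ℚ(ζ_n)` agree
  have : @IsGalois ℚ _ (cyclo n) _ (cyclo n).algebra' := by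
    convert hgal
    exact Subsingleton.elim _ _
  have hfin : Module.finrank ℚ (cyclo n) = n.totient := by
    have := isCyclotomicExtension_cyclo hn
    exact IsCyclotomicExtension.finrank (cyclo n)
      (Polynomial.cyclotomic.irreducible_rat (Nat.pos_of_ne_zero hn))
  have hsup : Module.finrank ℚ ↥(cyclo n ⊔ K) =
      Module.finrank ℚ K * Module.finrank K (IntermediateField.adjoin K {zeta n}) := by
    rw [sup_comm, ← IntermediateField.restrictScalars_adjoin_eq_sup]
    exact (Module.finrank_mul_finrank ℚ K (IntermediateField.adjoin K {zeta n})).symm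
  rw [ncard_galImage hn, ← IntermediateField.LinearDisjoint.iff_inf_eq_bot]
  constructor
  · intro h
    have := h.finrank_sup
    rw [hsup, hfin, mul_comm] at this
    exact mul_right_cancel₀ Module.finrank_pos.ne' this
  · intro h
    refine IntermediateField.LinearDisjoint.of_finrank_sup ?_
    rw [hsup, hfin, h, mul_comm]

end GaloisImage

end MetacyclicGroupAlgebra

theorem mainTheorem10 (F : Type*) [Field F] [NumberField F] (ι : F →ₐ[ℚ] ℂ)
    (q n k : ℕ) (t r : ℤ) (hq : q.Prime) (hqn : ¬ q ∣ n) (hk : k ∣ n)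
    (ht : (q : ℤ) ∣ t * (r - 1)) (hr : orderOf (r : ZMod q) = n / k) :
    (MetacyclicGroupAlgebra.HasMinimalComponents F
        (MetacyclicGroupAlgebra.MetacyclicGroup q n t r) ↔
      MetacyclicGroupAlgebra.cyclo n ⊓ ι.fieldRange = ⊥ ∧
        MetacyclicGroupAlgebra.bFixed q k r ⊓ ι.fieldRange = ⊥) ∧
    (MetacyclicGroupAlgebra.cyclo n ⊓ ι.fieldRange = ⊥ ↔
      (MetacyclicGroupAlgebra.galImage n ι.fieldRange).ncard = n.totient) := by
  open MetacyclicGroupAlgebra in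
  have hn0 : n ≠ 0 := by rintro rfl; exact hqn (dvd_zero q)
  have : FiniteDimensional ℚ ι.fieldRange :=
    (AlgEquiv.ofInjectiveField ι).toLinearEquiv.finiteDimensional
  refine ⟨?_, inf_cyclo_eq_bot_iff hn0 _⟩
  have hk0 : k ≠ 0 := by rintro rfl; exact hn0 (Nat.eq_zero_of_zero_dvd hk)
  have hn : n = n / k * k := (Nat.div_mul_cancel hk).symm
  have hm0 : n / k ≠ 0 := fun h => hn0 (by rw [hn, h, zero_mul])
  have hqk : q.Coprime k := (Nat.Prime.coprime_iff_not_dvd hq).mpr fun h => hqn (h.trans hk)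
  obtain ⟨a, b, ha, hb, hab, hg, hlift⟩ := exists_split_generators hq hqn ht
  have := finite_of_split_generators hq.ne_zero hn0 ha hb hg
  have he := avgElem_mem_center hq.ne_zero ha hab (isCoprime_of_orderOf hm0 hr) hg
  have hle := fun φ => adjoin_range_le φ hq hm0 hk0 hn ha hb hab hr hg
  have hgal : ∀ φ : Subalgebra.center ℚ (MonoidAlgebra ℚ (MetacyclicGroup q n t r)) →ₐ[ℚ] ℂ,
      FiniteDimensional ℚ (IntermediateField.adjoin ℚ (Set.range φ)) ∧
        IsGalois ℚ (IntermediateField.adjoin ℚ (Set.range φ)) := fun φ =>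
    (hle φ).elim (isGalois_of_le_cyclo hn0) fun h =>
      isGalois_of_le_cyclo (mul_ne_zero hq.ne_zero hk0) (h.trans (bFixed_le_cyclo q k r))
  rw [hasMinimalComponents_iff ι (fun φ => (hgal φ).1) (fun φ => (hgal φ).2)]
  constructor
  · intro h
    obtain ⟨φ, hφ⟩ := exists_algHom_zeta_mem_range hq.ne_zero hn0 ha hab hg he hlift
    obtain ⟨ψ, hψ⟩ := exists_algHom_bFixed_le hq hqk hk0 hm0 hn ha hab hr hg hlift
    exact ⟨le_bot_iff.mp ((inf_le_inf_right _ (cyclo_le_of_zeta_mem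
        (IntermediateField.subset_adjoin _ _ hφ))).trans (h φ).le),
      le_bot_iff.mp ((inf_le_inf_right _ hψ).trans (h ψ).le)⟩
  · rintro ⟨h1, h2⟩ φ
    exact (hle φ).elim (fun h => le_bot_iff.mp ((inf_le_inf_right _ h).trans h1.le))
      (fun h => le_bot_iff.mp ((inf_le_inf_right _ h).trans h2.le))
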